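/- Let $Q\ge 1$, $0<\gamma<1/Q$ and $\zeta>0$ be fixed. Let $\Theta$ be the set of pairs $(\alpha,\pi)$ such that $\alpha\in\mathbb R^Q$ satisfies $\sum_q\alpha_q=1$ and $\alpha_q\in[\gamma,1-\gamma]$ for all $q$ (A3), and $\pi=(\pi_{q,l})_{1\le q,l\le Q}$ has entries in $[0,1]$ with $\pi_{q,l}\in\,]0,1[\ \Rightarrow\ \pi_{q,l}\in[\zeta,1-\zeta]$ (A2). Let $(\alpha^*,\pi^*)\in\Theta$ be such that, in addition, for all $q\ne q'$ there is $l$ with $\pi^*_{q,l}\ne\pi^*_{q',l}$ or $\pi^*_{l,q}\neq\pi^*_{l,q'}$ (A1). Let $(Z_i)_i$, $(X_{i,j})_{i,j}$ be a (directed, binary) stochastic block model with parameters $(\alpha^*,\pi^*)$ under $\mathbb P$: the labels $Z_i\in\{1,\dots,Q\}$ are i.i.d. with $\mathbb P(Z_i=q)=\alpha^*_q$; given the labels, the edges $X_{i,j}\in\{0,1\}$, $i\ne j$, are independent Bernoulli variables with parameters $\pi^*_{Z_i,Z_j}$; and $X_{i,i}=0$. For an adjacency matrix $x$ on $n$ vertices,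 put $$\mathcal L_2(x;\alpha,\pi)=\log\sum_{z\in\{1,\dots,Q\}^n}\ \prod_{i\neq j}\pi_{z_i,z_j}^{x_{i,j}}(1-\pi_{z_i,z_j})^{1-x_{i,j}}\prod_i\alpha_{z_i}\in[-\infty,\infty),$$ and let $P^{x}_{\alpha,\pi}$ be the posterior distribution of $(Z_1,\dots,Z_n)$ given $x$ under the parameters $(\alpha,\pi)$. For $\tau=(\tau_{i,q})\in\mathcal S_n=\{\tau\in([0,1]^Q)^n:\ \sum_q\tau_{i,q}=1\ \forall i\}$, let $D_\tau$ be the product distribution $D_\tau(z)=\prod_{i=1}^n\tau_{i,z_i}$ and $$\mathcal J(x;\tau,\alpha,\pi)=\mathcal L_2(x;\alpha,\pi)-K(D_\tau,P^x_{\alpha,\pi}),$$ where $K$ is the Kullback–Leibler divergence and $\mathcal J=-\infty$ if $\mathcal L_2=-\infty$. For every $n$, let the variational estimators $(\tilde\alpha,\tilde\pi)=(\tilde\alpha^{(n)},\tilde\pi^{(n)})$ be any function of $X_{[n]}=(X_{i,j})_{i,j\le n}$ that maximizes $(\alpha,\pi)\mapsto\max_{\tau\in\mathcal S_n}\mathcal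 J(X_{[n]};\tau,\alpha,\pi)$ over $\Theta$. Assume that $\tilde\pi$ converges to $\pi^*$ at rate $1/n$, i.e. $\|\tilde\pi-\pi^*\|_\infty=O_{\mathbb P}(1/n)$. Then $\tilde\alpha$ is a consistent estimator of $\alpha^*$, up to those permutations of the labels that leave $\pi^*$ invariant: with $\mathfrak S^{\pi^*}=\{\sigma\in\mathfrak S_Q:\ \pi^*_{\sigma(q),\sigma(l)}=\pi^*_{q,l}\ \forall q,l\}$ and $\tilde\alpha^\sigma=(\tilde\alpha_{\sigma(q)})_q$, for every distance $d$ on $\mathbb R^Q$ that induces the usual topology, $$\min_{\sigma\in\mathfrak S^{\pi^*}}d(\tilde\alpha^\sigma,\alpha^*)\xrightarrow[n\to\infty]{\mathbb P}0 .$$ In particular $d(\tilde\alpha,\alpha^*)\to0$ in probability whenever $\mathfrak S^{\pi^*}=\{\mathrm{Id}\}$. -/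

import Mathlib

open MeasureTheory ProbabilityTheory Filter Topology

noncomputable section

namespace SBM

/-- An observed adjacency matrix on `n` vertices (`true` means an edge from `i` to `j`). -/
abbrev Graph (n : ℕ) : Type := Fin n → Fin n → Bool

/-- Group proportions `α = (α_q)`. -/
abbrev Mix (Q : ℕ) : Type := Fin Q → ℝ

/-- Connection probabilities `π = (π_{q,l})`; the norm on this type is the sup norm. -/
abbrev Conn (Q : ℕ) : Type := Fin Q → Fin Q → ℝ

/-! ### Assumptions on the parameters -/

/-- No two classes have the same rows and the same columns. -/
def DistinctClasses {Q : ℕ} (π : Conn Q) : Prop :=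
  ∀ q q' : Fin Q, q ≠ q' → ∃ l : Fin Q, π q l ≠ π q' l ∨ π l q ≠ π l q'

/-- The connection probabilities lie in `[0,1]`, and those that lie in `]0,1[` lie in
`[ζ, 1-ζ]`. -/
def TruncConn {Q : ℕ} (ζ : ℝ) (π : Conn Q) : Prop :=
  ∀ q l : Fin Q, π q l ∈ Set.Icc (0 : ℝ) 1 ∧
    (π q l ∈ Set.Ioo (0 : ℝ) 1 → π q l ∈ Set.Icc ζ (1 - ζ))

/-- `α` is a probability vector all of whose entries lie in `[γ, 1-γ]`. -/
def TruncMix {Q : ℕ} (γ : ℝ) (α : Mix Q) : Prop :=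
  ∑ q, α q = 1 ∧ ∀ q : Fin Q, α q ∈ Set.Icc γ (1 - γ)

/-- The permutations of the labels that leave `π` invariant. -/
def invPerms {Q : ℕ} (π : Conn Q) : Set (Equiv.Perm (Fin Q)) :=
  {σ | ∀ q l : Fin Q, π (σ q) (σ l) = π q l}

/-! ### The model -/

/-- `exp (L₁(x; z, π))`: the probability of the edges `x` given the labels `z`. -/
def edgeLik {Q n : ℕ} (π : Conn Q) (x : Graph n) (z : Fin n → Fin Q) : ℝ :=
  ∏ i : Fin n, ∏ j : Fin n,
    if i = j then 1 else if x i j then π (z i) (z j) else 1 - π (z i) (z j)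

/-- The random graph `X` with latent labels `Z` is a stochastic block model with parameters
`(α, π)` under `P`: the labels are i.i.d. with law `α` and, given the labels, the edges
`X i j`, `i ≠ j`, are independent Bernoulli variables with parameters `π (Z i) (Z j)`. -/
structure IsSBM {Q : ℕ} {Ω : Type*} [MeasurableSpace Ω] (P : Measure Ω)
    (α : Mix Q) (π : Conn Q) (Z : ℕ → Ω → Fin Q) (X : ℕ → ℕ → Ω → Bool) : Prop where
  measurable_label : ∀ i, Measurable (Z i)
  measurable_edge : ∀ i j, Measurable (X i j)
  no_loop : ∀ i ω, X i i ω = false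
  label_indep : iIndepFun Z P
  label_law : ∀ i q, P {ω | Z i ω = q} = ENNReal.ofReal (α q)
  edge_law : ∀ (n : ℕ) (z : Fin n → Fin Q) (x : Graph n),
    P {ω | (∀ i : Fin n, Z i ω = z i) ∧ ∀ i j : Fin n, i ≠ j → X i j ω = x i j} =
      P {ω | ∀ i : Fin n, Z i ω = z i} * ENNReal.ofReal (edgeLik π x z)

/-- `X_{[n]}`: the adjacency matrix of the first `n` vertices. -/
def adj {Ω : Type*} (X : ℕ → ℕ → Ω → Bool) (n : ℕ) (ω : Ω) : Graph n :=
  fun i j => X i j ω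

/-! ### Likelihood, posterior distribution and variational log-likelihood -/

/-- The complete-data likelihood of labels `z` and edges `x`. -/
def jointLik {Q n : ℕ} (α : Mix Q) (π : Conn Q) (x : Graph n) (z : Fin n → Fin Q) : ℝ :=
  edgeLik π x z * ∏ i, α (z i)

/-- The likelihood of the observed graph `x`. -/
def lik {Q n : ℕ} (α : Mix Q) (π : Conn Q) (x : Graph n) : ℝ :=
  ∑ z : Fin n → Fin Q, jointLik α π x z

/-- The log-likelihood `L₂(x; α, π)`, equal to `-∞` if `x` is impossible under `(α, π)`. -/
def logLik {Q n : ℕ} (α : Mix Q) (π : Conn Q) (x : Graph n) : EReal :=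
  ENNReal.log (ENNReal.ofReal (lik α π x))

/-- The measure on a finite space with point masses `w`. -/
def weighted {ι : Type*} [Fintype ι] [MeasurableSpace ι] (w : ι → ℝ) : Measure ι :=
  ∑ z, ENNReal.ofReal (w z) • Measure.dirac z

/-- The posterior distribution of the labels given the graph `x`, under `(α, π)`. -/
def labelPosterior {Q n : ℕ} (α : Mix Q) (π : Conn Q) (x : Graph n) :
    Measure (Fin n → Fin Q) :=
  weighted fun z => jointLik α π x z / lik α π x

/-- The set `S_n` of variational parameters: `n` probability vectors on the `Q` classes. -/
def tauSet (n Q : ℕ) : Set (Fin n → Fin Q → ℝ) :=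
  {τ | ∀ i, (∀ q, τ i q ∈ Set.Icc (0 : ℝ) 1) ∧ ∑ q, τ i q = 1}

/-- `D_τ`: the product of the multinomial distributions `M(1; τ_i)`. -/
def prodMult {Q n : ℕ} (τ : Fin n → Fin Q → ℝ) : Measure (Fin n → Fin Q) :=
  weighted fun z => ∏ i, τ i (z i)

/-- The variational log-likelihood `J(x; τ, α, π) = L₂(x; α, π) - K(D_τ, P^x)`.
It is `-∞` if `x` is impossible under `(α, π)`, or if `D_τ` is not absolutely continuous with
respect to the posterior distribution. -/
def varLogLik {Q n : ℕ} (x : Graph n) (τ : Fin n → Fin Q → ℝ) (α : Mix Q) (π : Conn Q) :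
    EReal :=
  logLik α π x - (InformationTheory.klDiv (prodMult τ) (labelPosterior α π x) : EReal)

/-- `τ` is a maximizer `τ̂(α, π)` of the variational log-likelihood at `(α, π)`. -/
def IsTauHat {Q n : ℕ} (x : Graph n) (α : Mix Q) (π : Conn Q) (τ : Fin n → Fin Q → ℝ) :
    Prop :=
  τ ∈ tauSet n Q ∧ ∀ τ' ∈ tauSet n Q, varLogLik x τ' α π ≤ varLogLik x τ α π

/-- `(α, π)` is a variational estimate computed from the graph `x`: it maximizes
`max_τ J(x; τ, α, π) = J(x; τ̂(α, π), α, π)` over the parameters that satisfy `TruncConn` with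
constant `ζ` and `TruncMix` with constant `γ`. -/
def IsVE {Q n : ℕ} (ζ γ : ℝ) (x : Graph n) (α : Mix Q) (π : Conn Q) : Prop :=
  TruncMix γ α ∧ TruncConn ζ π ∧ ∃ τ, IsTauHat x α π τ ∧
    ∀ (α' : Mix Q) (π' : Conn Q), TruncMix γ α' → TruncConn ζ π' →
      ∀ τ' ∈ tauSet n Q, varLogLik x τ' α' π' ≤ varLogLik x τ α π

/-! ### Modes of convergence -/

/-- `‖πt n - π‖_∞ = O_P(1/n)`. -/
def ConvAtRateInv {Q : ℕ} {Ω : Type*} [MeasurableSpace Ω] (P : Measure Ω)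
    (πt : ℕ → Ω → Conn Q) (π : Conn Q) : Prop :=
  ∀ ε : ℝ, 0 < ε → ∃ M : ℝ, ∀ᶠ n : ℕ in atTop,
    P {ω | M < (n : ℝ) * ‖πt n ω - π‖} ≤ ENNReal.ofReal ε

/-- `d` is a distance on `ℝ^Q` that induces the usual topology. -/
def IsUsualDist {Q : ℕ} (d : Mix Q → Mix Q → ℝ) : Prop :=
  ∃ m : MetricSpace (Fin Q → ℝ),
    m.toUniformSpace.toTopologicalSpace = Pi.topologicalSpace ∧ ∀ a b, d a b = m.dist a b

end SBM

end

noncomputable section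

namespace SBM

/-! ### Variational estimates dominate the complete-data likelihood -/

/-! The estimate `(α̃, π̃)` is compared with the competitor that keeps `π̃`, replaces `α̃` by the
true `α*`, and takes for `τ` the point mass at the true labels `z*`. Since a divergence is
nonnegative, this gives `jointLik α* π̃ x z* ≤ lik α̃ π̃ x` (`jointLik_le_lik_of_isVE`). The
variational criterion plays no further role.

It remains to see that, up to a factor `exp (δ n)` with `δ` arbitrary, the likelihood is carried by
the relabelings of `z*` under `invPerms π*`. For every `z`, some such `σ` gives at least `c n r`
pairs whose connection probabilities differ under `z` and `z*`, where `r` is the Hamming distance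
from `z` to `σ(z*)` (`exists_invPerm_card_mismatch_ge`). Under `π*` the Hellinger affinity of the
two graph laws is then at most `exp (-κ c n r)`, which beats every factor `C ^ r` and the number of
labelings (`IsSBM.tendsto_farLik`).

Passing from `π*` to `π̃` costs only such factors, thanks to the rate: with an error `M / n`, the at
most `2 n r` pairs touching a disagreement contribute `exp (4 M r / ζ)` (`edgeLik_mul_edgeLik_le`).
At `z*` itself, moving between `π̃` and its relabeling costs `O(1/n)` times centred block counts,
which are `o(n²)`, plus a second-order term `O(1)` (`edgeLik_le_mul_exp_blockDev`).

Cancelling the edge likelihood at `z*` leaves `∏ α*(z*_i) ≤ exp (δ n) ∏ α̃(σ(z*_i))`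
(`exists_invPerm_prod_le`). By the law of large numbers, the Kullback–Leibler divergence from `α*`
to `α̃^σ` is small, and it dominates the squared distance (`sq_sub_le_of_kl_le`). -/

lemma weighted_apply_singleton {ι : Type*} [Fintype ι] [MeasurableSpace ι]
    [MeasurableSingletonClass ι] (w : ι → ℝ) (z : ι) :
    weighted w {z} = ENNReal.ofReal (w z) := by
  classical
  simp only [weighted, Measure.finsetSum_apply, Measure.smul_apply, smul_eq_mul,
    Measure.dirac_apply' _ (MeasurableSet.singleton z), Set.indicator_apply,
    Set.mem_singleton_iff, Pi.one_apply, mul_ite, mul_one, mul_zero]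
  simp

lemma weighted_univ {ι : Type*} [Fintype ι] [MeasurableSpace ι] (w : ι → ℝ)
    (hw : ∀ i, 0 ≤ w i) : weighted w Set.univ = ENNReal.ofReal (∑ i, w i) := by
  simp [weighted, Measure.finsetSum_apply, ENNReal.ofReal_sum_of_nonneg (fun i _ => hw i)]

lemma isProbabilityMeasure_weighted {ι : Type*} [Fintype ι] [MeasurableSpace ι] (w : ι → ℝ)
    (hw : ∀ i, 0 ≤ w i) (hw1 : ∑ i, w i = 1) : IsProbabilityMeasure (weighted w) :=
  ⟨by rw [weighted_univ w hw, hw1, ENNReal.ofReal_one]⟩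

/-- The density of the point mass is `1 / w z` at `z`, so the divergence is the integral of a single
logarithm. -/
lemma klDiv_dirac_weighted {ι : Type*} [Fintype ι] [MeasurableSpace ι]
    [MeasurableSingletonClass ι] (w : ι → ℝ) (hw : ∀ i, 0 ≤ w i) (hw1 : ∑ i, w i = 1) (z : ι)
    (hz : 0 < w z) :
    InformationTheory.klDiv (Measure.dirac z) (weighted w) =
      ENNReal.ofReal (-Real.log (w z)) := by
  classical
  have : IsProbabilityMeasure (weighted w) := isProbabilityMeasure_weighted w hw hw1
  have hne : ENNReal.ofReal (w z) ≠ 0 := by simpa using hz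
  set f : ι → ENNReal := fun i => if i = z then (ENNReal.ofReal (w z))⁻¹ else 0 with hf
  have hfm : Measurable f := measurable_of_finite f
  have hd : Measure.dirac z = (weighted w).withDensity f := by
    refine Measure.ext_of_singleton fun i => ?_
    rw [withDensity_apply _ (MeasurableSet.singleton i), lintegral_singleton,
      weighted_apply_singleton, Measure.dirac_apply' _ (MeasurableSet.singleton i)]
    by_cases h : i = z
    · subst h
      simp [hf, ENNReal.inv_mul_cancel hne]
    · simp [hf, h, Ne.symm h]
  have hac : Measure.dirac z ≪ weighted w := hd ▸ withDensity_absolutelyContinuous _ _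
  have hrn : (Measure.dirac z).rnDeriv (weighted w) =ᵐ[Measure.dirac z] f := by
    have h := Measure.rnDeriv_withDensity (weighted w) hfm
    rw [← hd] at h
    exact hac.ae_le h
  have hrz : (Measure.dirac z).rnDeriv (weighted w) z = (ENNReal.ofReal (w z))⁻¹ := by
    have h := hrn
    rw [Filter.EventuallyEq, ae_dirac_eq] at h
    simpa [hf] using h
  rw [InformationTheory.klDiv_of_ac_of_integrable hac Integrable.of_finite, integral_dirac]
  simp [llr, hrz, ENNReal.toReal_inv, ENNReal.toReal_ofReal hz.le, Real.log_inv]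

lemma prodMult_pointMass {Q n : ℕ} (z : Fin n → Fin Q) :
    prodMult (fun i q => if z i = q then (1 : ℝ) else 0) = Measure.dirac z := by
  refine Measure.ext_of_singleton fun w => ?_
  rw [prodMult, weighted_apply_singleton, Measure.dirac_apply' _ (MeasurableSet.singleton w)]
  by_cases h : z = w
  · subst h; simp
  · obtain ⟨i, hi⟩ := Function.ne_iff.1 h
    rw [Finset.prod_eq_zero (Finset.mem_univ i) (by simp [hi])]
    simp [h]

lemma pointMass_mem_tauSet {Q n : ℕ} (z : Fin n → Fin Q) :
    (fun i q => if z i = q then (1 : ℝ) else 0) ∈ tauSet n Q := by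
  intro i
  refine ⟨fun q => ?_, by simp⟩
  by_cases h : z i = q <;> simp [h]

lemma edgeLik_nonneg {Q n : ℕ} {π : Conn Q} (hπ : ∀ q l, π q l ∈ Set.Icc (0 : ℝ) 1)
    (x : Graph n) (z : Fin n → Fin Q) : 0 ≤ edgeLik π x z := by
  refine Finset.prod_nonneg fun i _ => Finset.prod_nonneg fun j _ => ?_
  have := hπ (z i) (z j)
  split_ifs
  · exact zero_le_one
  · exact this.1
  · linarith [this.2]

lemma jointLik_nonneg {Q n : ℕ} {α : Mix Q} {π : Conn Q}
    (hα : ∀ q, 0 ≤ α q) (hπ : ∀ q l, π q l ∈ Set.Icc (0 : ℝ) 1)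
    (x : Graph n) (z : Fin n → Fin Q) : 0 ≤ jointLik α π x z :=
  mul_nonneg (edgeLik_nonneg hπ x z) (Finset.prod_nonneg fun i _ => hα (z i))

lemma varLogLik_pointMass {Q n : ℕ} {α : Mix Q} {π : Conn Q} (hα : ∀ q, 0 ≤ α q)
    (hπ : ∀ q l, π q l ∈ Set.Icc (0 : ℝ) 1) (x : Graph n) (z : Fin n → Fin Q)
    (hz : 0 < jointLik α π x z) :
    varLogLik x (fun i q => if z i = q then (1 : ℝ) else 0) α π =
      ((Real.log (jointLik α π x z) : ℝ) : EReal) := by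
  have hnn := fun z => jointLik_nonneg hα hπ x z
  have hle : jointLik α π x z ≤ lik α π x :=
    Finset.single_le_sum (f := fun z => jointLik α π x z) (fun i _ => hnn i) (Finset.mem_univ z)
  have hL : 0 < lik α π x := hz.trans_le hle
  -- The posterior mass is at most `1`, so its negative logarithm is not truncated by
  -- `ENNReal.ofReal`.
  have hfrac : jointLik α π x z / lik α π x ≤ 1 := (div_le_one hL).2 hle
  rw [varLogLik, prodMult_pointMass, labelPosterior,
    klDiv_dirac_weighted _ (fun i => div_nonneg (hnn i) hL.le)
      (by rw [← Finset.sum_div]; exact div_self hL.ne') z (div_pos hz hL),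
    logLik, ENNReal.log_ofReal, if_neg hL.not_ge, EReal.coe_ennreal_ofReal,
    max_eq_left (neg_nonneg.2 (Real.log_nonpos (div_nonneg (hnn z) hL.le) hfrac)),
    ← EReal.coe_sub, Real.log_div hz.ne' hL.ne']
  congr 1
  ring

/-- Keeping the estimated `π` on both sides isolates the effect of the proportions: the competitor
differs from the estimate only in `α'` and `τ`. -/
lemma jointLik_le_lik_of_isVE {Q n : ℕ} {ζ γ : ℝ} {α α' : Mix Q} {π : Conn Q} {x : Graph n}
    (hγ : 0 ≤ γ) (hVE : IsVE ζ γ x α π) (hα' : TruncMix γ α') (z : Fin n → Fin Q)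
    (hz : 0 < jointLik α' π x z) : jointLik α' π x z ≤ lik α π x := by
  obtain ⟨-, hπ, τ, -, hmax⟩ := hVE
  have h := hmax α' π hα' hπ _ (pointMass_mem_tauSet z)
  rw [varLogLik_pointMass (fun q => hγ.trans (hα'.2 q).1) (fun q l => (hπ q l).1) x z hz] at h
  have h2 : ((Real.log (jointLik α' π x z) : ℝ) : EReal) ≤ logLik α π x :=
    h.trans (EReal.sub_le_of_le_add' (le_add_of_nonneg_left (EReal.coe_ennreal_nonneg _)))
  rw [logLik, ENNReal.log_ofReal] at h2
  split_ifs at h2 with h3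
  · simp at h2
  · exact (Real.log_le_log_iff hz (not_le.1 h3)).1 (by exact_mod_cast h2)

/-! ### Finite product sums and the law of the labelled graph -/

/-- The probability of the outcome `b` under the Bernoulli law with parameter `p`. -/
def bern (p : ℝ) (b : Bool) : ℝ := if b then p else 1 - p

/-- The probability of the graph `x`, loops included, given the labels `z`. -/
def graphProb {Q n : ℕ} (π : Conn Q) (z : Fin n → Fin Q) (x : Graph n) : ℝ :=
  ∏ i, ∏ j, if i = j then (if x i j then 0 else 1) else bern (π (z i) (z j)) (x i j)

lemma bern_nonneg {p : ℝ} (hp : p ∈ Set.Icc (0 : ℝ) 1) (b : Bool) : 0 ≤ bern p b := by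
  cases b
  · simpa [bern] using hp.2
  · simpa [bern] using hp.1

lemma edgeLik_eq_prod_bern {Q n : ℕ} (π : Conn Q) (x : Graph n) (z : Fin n → Fin Q) :
    edgeLik π x z = ∏ i, ∏ j, if i = j then 1 else bern (π (z i) (z j)) (x i j) := rfl

lemma graphProb_nonneg {Q n : ℕ} {π : Conn Q} (hπ : ∀ q l, π q l ∈ Set.Icc (0 : ℝ) 1)
    (z : Fin n → Fin Q) (x : Graph n) : 0 ≤ graphProb π z x := by
  refine Finset.prod_nonneg fun i _ => Finset.prod_nonneg fun j _ => ?_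
  split_ifs
  · exact le_rfl
  · exact zero_le_one
  · exact bern_nonneg (hπ _ _) _

lemma graphProb_eq_edgeLik {Q n : ℕ} (π : Conn Q) (z : Fin n → Fin Q) {x : Graph n}
    (hx : ∀ i, x i i = false) : graphProb π z x = edgeLik π x z := by
  refine Finset.prod_congr rfl fun i _ => Finset.prod_congr rfl fun j _ => ?_
  by_cases h : i = j
  · subst h; simp [hx]
  · simp [h, bern]

lemma loopless_of_graphProb_ne_zero {Q n : ℕ} {π : Conn Q} {z : Fin n → Fin Q} {x : Graph n}
    (h : graphProb π z x ≠ 0) (i : Fin n) : x i i = false := by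
  rw [graphProb, Finset.prod_ne_zero_iff] at h
  have h2 := Finset.prod_ne_zero_iff.1 (h i (Finset.mem_univ i)) i (Finset.mem_univ i)
  simpa using h2

lemma sum_labels_prod {Q n : ℕ} (h : Fin n → Fin Q → ℝ) :
    ∑ z : Fin n → Fin Q, ∏ i, h i (z i) = ∏ i, ∑ q, h i q := by
  rw [Finset.prod_univ_sum, Fintype.piFinset_univ]

lemma sum_graph_prod {n : ℕ} (h : Fin n → Fin n → Bool → ℝ) :
    ∑ x : Graph n, ∏ i, ∏ j, h i j (x i j) = ∏ i, ∏ j, (h i j true + h i j false) := by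
  have h1 : ∀ i, ∏ j, (h i j true + h i j false) =
      ∑ y : Fin n → Bool, ∏ j, h i j (y j) := fun i => by
    rw [← Fintype.piFinset_univ, ← Finset.prod_univ_sum]
    simp
  simp only [h1]
  rw [Finset.prod_univ_sum, Fintype.piFinset_univ]

lemma sum_graphProb {Q n : ℕ} (π : Conn Q) (z : Fin n → Fin Q) :
    ∑ x, graphProb π z x = 1 := by
  unfold graphProb
  rw [sum_graph_prod (fun i j b => if i = j then (if b then 0 else 1)
    else bern (π (z i) (z j)) b)]
  refine Finset.prod_eq_one fun i _ => Finset.prod_eq_one fun j _ => ?_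
  by_cases h : i = j <;> simp [h, bern]

lemma IsSBM.measure_labels {Q : ℕ} {Ω : Type*} [MeasurableSpace Ω] {P : Measure Ω}
    {α : Mix Q} {π : Conn Q} {Z : ℕ → Ω → Fin Q} {X : ℕ → ℕ → Ω → Bool}
    (h : IsSBM P α π Z X) {n : ℕ} (z : Fin n → Fin Q) :
    P {ω | ∀ i : Fin n, Z i ω = z i} = ∏ i, ENNReal.ofReal (α (z i)) := by
  have hi := (h.label_indep.precomp (g := fun i : Fin n => (i : ℕ)) Fin.val_injective)
  have h2 := hi.measure_inter_preimage_eq_mul Finset.univ (sets := fun i => {z i})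
    (fun i _ => MeasurableSet.singleton _)
  have h3 : {ω | ∀ i : Fin n, Z i ω = z i} =
      ⋂ i ∈ (Finset.univ : Finset (Fin n)), (fun ω => Z i ω) ⁻¹' {z i} := by
    ext ω
    simp
  rw [h3, h2]
  exact Finset.prod_congr rfl fun i _ => h.label_law i (z i)

lemma IsSBM.measure_cell {Q : ℕ} {Ω : Type*} [MeasurableSpace Ω] {P : Measure Ω}
    {α : Mix Q} {π : Conn Q} {Z : ℕ → Ω → Fin Q} {X : ℕ → ℕ → Ω → Bool}
    (h : IsSBM P α π Z X) (hα : ∀ q, 0 ≤ α q) {n : ℕ} (z : Fin n → Fin Q) (x : Graph n) :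
    P {ω | (fun i : Fin n => Z i ω) = z ∧ adj X n ω = x} ≤
      ENNReal.ofReal ((∏ i, α (z i)) * graphProb π z x) := by
  by_cases hx : ∀ i, x i i = false
  · have h1 : {ω | (fun i : Fin n => Z i ω) = z ∧ adj X n ω = x} ⊆
        {ω | (∀ i : Fin n, Z i ω = z i) ∧ ∀ i j : Fin n, i ≠ j → X i j ω = x i j} := by
      rintro ω ⟨h1, h2⟩
      exact ⟨fun i => congrFun h1 i, fun i j _ => congrFun (congrFun h2 i) j⟩
    refine (measure_mono h1).trans ?_
    rw [h.edge_law, h.measure_labels, graphProb_eq_edgeLik π z hx,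
      ENNReal.ofReal_mul (Finset.prod_nonneg fun i _ => hα _),
      ENNReal.ofReal_prod_of_nonneg (fun i _ => hα _)]
  · obtain ⟨i, hi⟩ := not_forall.1 hx
    have : {ω | (fun i : Fin n => Z i ω) = z ∧ adj X n ω = x} = ∅ := by
      ext ω
      simp only [Set.mem_ofPred_eq, Set.mem_empty_iff_false, iff_false, not_and]
      rintro - h2
      exact hi ((congrFun (congrFun h2 i) i).symm.trans (h.no_loop i ω))
    rw [this]
    simp

/-- Markov's inequality for the labelled graph. -/
lemma IsSBM.measure_le_of_one_le {Q : ℕ} {Ω : Type*} [MeasurableSpace Ω] {P : Measure Ω}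
    {α : Mix Q} {π : Conn Q} {Z : ℕ → Ω → Fin Q} {X : ℕ → ℕ → Ω → Bool}
    (h : IsSBM P α π Z X) (hα : ∀ q, 0 ≤ α q) (hπ : ∀ q l, π q l ∈ Set.Icc (0 : ℝ) 1) {n : ℕ}
    (B : (Fin n → Fin Q) → Graph n → Prop) (F : (Fin n → Fin Q) → Graph n → ℝ)
    (hF : ∀ z x, 0 ≤ F z x) (hB : ∀ z x, B z x → 0 < graphProb π z x → 1 ≤ F z x) :
    P {ω | B (fun i : Fin n => Z i ω) (adj X n ω)} ≤
      ENNReal.ofReal (∑ z, (∏ i, α (z i)) * ∑ x, graphProb π z x * F z x) := by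
  classical
  have hα' : ∀ z : Fin n → Fin Q, 0 ≤ ∏ i, α (z i) := fun z =>
    Finset.prod_nonneg fun i _ => hα _
  set S : Finset ((Fin n → Fin Q) × Graph n) := Finset.univ.filter fun p => B p.1 p.2
  have hsub : {ω | B (fun i : Fin n => Z i ω) (adj X n ω)} ⊆
      ⋃ p ∈ S, {ω | (fun i : Fin n => Z i ω) = p.1 ∧ adj X n ω = p.2} := by
    intro ω hω
    simp only [Set.mem_iUnion]
    exact ⟨(fun i : Fin n => Z i ω, adj X n ω), by simpa [S] using hω, rfl, rfl⟩
  calc P {ω | B (fun i : Fin n => Z i ω) (adj X n ω)}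
      ≤ ∑ p ∈ S, P {ω | (fun i : Fin n => Z i ω) = p.1 ∧ adj X n ω = p.2} :=
        (measure_mono hsub).trans (measure_biUnion_finset_le _ _)
    _ ≤ ∑ p ∈ S, ENNReal.ofReal ((∏ i, α (p.1 i)) * (graphProb π p.1 p.2 * F p.1 p.2)) := by
        refine Finset.sum_le_sum fun p hp => (h.measure_cell hα p.1 p.2).trans ?_
        refine ENNReal.ofReal_le_ofReal (mul_le_mul_of_nonneg_left ?_ (hα' _))
        -- `F` may be small on graphs of probability zero, which contribute nothing.
        rcases (graphProb_nonneg hπ p.1 p.2).eq_or_lt with h0 | h0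
        · simp [← h0]
        · exact le_mul_of_one_le_right h0.le (hB _ _ (by simpa [S] using hp) h0)
    _ ≤ ∑ p : (Fin n → Fin Q) × Graph n,
          ENNReal.ofReal ((∏ i, α (p.1 i)) * (graphProb π p.1 p.2 * F p.1 p.2)) :=
        Finset.sum_le_univ_sum_of_nonneg fun _ => zero_le
    _ = ENNReal.ofReal (∑ z, (∏ i, α (z i)) * ∑ x, graphProb π z x * F z x) := by
        rw [← ENNReal.ofReal_sum_of_nonneg fun p _ =>
          mul_nonneg (hα' _) (mul_nonneg (graphProb_nonneg hπ _ _) (hF _ _))]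
        simp only [Finset.mul_sum]
        rw [Fintype.sum_prod_type]

/-! ### Concentration -/

/-- Follows from `exp y ≤ 1 + y + y ^ 2` for `|y| ≤ 1`, whose linear term vanishes by centring. -/
lemma sum_mul_exp_le {ι : Type*} [Fintype ι] (w u : ι → ℝ) (hw : ∀ i, 0 ≤ w i)
    (hw1 : ∑ i, w i = 1) (hu : ∑ i, w i * u i = 0) (hu1 : ∀ i, |u i| ≤ 1) {t : ℝ}
    (ht0 : 0 ≤ t) (ht1 : t ≤ 1) :
    ∑ i, w i * Real.exp (t * u i) ≤ Real.exp (t ^ 2) := by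
  have h1 : ∀ i, Real.exp (t * u i) ≤ 1 + t * u i + t ^ 2 := fun i => by
    have h2 : |t * u i| ≤ t := by
      rw [abs_mul, abs_of_nonneg ht0]
      exact mul_le_of_le_one_right ht0 (hu1 i)
    have h3 := (abs_le.1 (Real.abs_exp_sub_one_sub_id_le (h2.trans ht1))).2
    have h4 : (t * u i) ^ 2 ≤ t ^ 2 := sq_le_sq' (by linarith [(abs_le.1 h2).1]) (abs_le.1 h2).2
    linarith
  calc ∑ i, w i * Real.exp (t * u i) ≤ ∑ i, (w i + t * (w i * u i) + t ^ 2 * w i) :=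
        Finset.sum_le_sum fun i _ => by
          nlinarith [mul_le_mul_of_nonneg_left (h1 i) (hw i)]
    _ = t ^ 2 + 1 := by
        rw [Finset.sum_add_distrib, Finset.sum_add_distrib, ← Finset.mul_sum, ← Finset.mul_sum,
          hw1, hu]
        ring
    _ ≤ _ := Real.add_one_le_exp _

/-- The centred number of edges from class `q` to class `l`. -/
def blockDev {Q n : ℕ} (π : Conn Q) (q l : Fin Q) (z : Fin n → Fin Q) (x : Graph n) : ℝ :=
  ∑ i, ∑ j, if i ≠ j ∧ z i = q ∧ z j = l then (if x i j then 1 else 0) - π q l else 0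

/-- The centred size of the class `q`. -/
def classDev {Q n : ℕ} (α : Mix Q) (q : Fin Q) (z : Fin n → Fin Q) : ℝ :=
  ∑ i, ((if z i = q then 1 else 0) - α q)

/-- Given the labels the edges are independent, so the exponential moment is a product over `n ^ 2`
pairs with factors at most `exp (t ^ 2)`. The sign `s` serves both tails. -/
lemma sum_graphProb_mul_exp_blockDev {Q n : ℕ} {π : Conn Q}
    (hπ : ∀ q l, π q l ∈ Set.Icc (0 : ℝ) 1) (q l : Fin Q) (z : Fin n → Fin Q) {s t : ℝ}
    (hs : |s| = 1) (ht0 : 0 ≤ t) (ht1 : t ≤ 1) :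
    ∑ x, graphProb π z x * Real.exp (t * (s * blockDev π q l z x)) ≤
      Real.exp (t ^ 2 * n ^ 2) := by
  set h : Fin n → Fin n → Bool → ℝ := fun i j b =>
    (if i = j then (if b then 0 else 1) else bern (π (z i) (z j)) b) *
      Real.exp (t * (s * if i ≠ j ∧ z i = q ∧ z j = l then (if b then 1 else 0) - π q l else 0))
    with hh
  have h1 : ∀ x : Graph n, graphProb π z x * Real.exp (t * (s * blockDev π q l z x)) =
      ∏ i, ∏ j, h i j (x i j) := fun x => by
    simp only [hh, Finset.prod_mul_distrib, blockDev, Finset.mul_sum, Real.exp_sum, graphProb]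
  have hnn : ∀ i j b, 0 ≤ h i j b := fun i j b => by
    refine mul_nonneg ?_ (Real.exp_pos _).le
    split_ifs
    · exact le_rfl
    · exact zero_le_one
    · exact bern_nonneg (hπ _ _) _
  have hle : ∀ i j, h i j true + h i j false ≤ Real.exp (t ^ 2) := fun i j => by
    by_cases hij : i = j
    · simp [hh, hij, sq_nonneg t]
    · by_cases hb : z i = q ∧ z j = l
      · have hp := hπ q l
        have h2 := sum_mul_exp_le (fun b : Bool => bern (π q l) b)
          (fun b => s * ((if b then 1 else 0) - π q l)) (fun b => bern_nonneg hp b)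
          (by simp [bern]) (by simp [bern]; ring)
          (fun b => by
            rw [abs_mul, hs, one_mul, abs_le]
            cases b
            · simp only [Bool.false_eq_true, if_false]
              constructor <;> linarith [hp.1, hp.2]
            · simp only [if_true]
              constructor <;> linarith [hp.1, hp.2]) ht0 ht1
        simpa [hh, hij, hb] using h2
      · simp [hh, hij, hb, bern, sq_nonneg t]
  simp only [h1]
  rw [sum_graph_prod]
  calc ∏ i, ∏ j, (h i j true + h i j false) ≤ ∏ _i : Fin n, ∏ _j : Fin n, Real.exp (t ^ 2) :=
        Finset.prod_le_prod
          (fun i _ => Finset.prod_nonneg fun j _ => add_nonneg (hnn _ _ _) (hnn _ _ _))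
          fun i _ => Finset.prod_le_prod (fun j _ => add_nonneg (hnn _ _ _) (hnn _ _ _))
            fun j _ => hle i j
    _ = _ := by
        simp only [Finset.prod_const, Finset.card_univ, Fintype.card_fin, ← Real.exp_nat_mul]
        congr 1
        ring

lemma sum_labels_mul_exp_classDev {Q n : ℕ} {α : Mix Q} (hα : ∀ q, 0 ≤ α q)
    (hα1 : ∑ q, α q = 1) (q : Fin Q) {s t : ℝ}
    (hs : |s| = 1) (ht0 : 0 ≤ t) (ht1 : t ≤ 1) :
    ∑ z : Fin n → Fin Q, (∏ i, α (z i)) * Real.exp (t * (s * classDev α q z)) ≤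
      Real.exp (t ^ 2 * n) := by
  have h1 : ∀ z : Fin n → Fin Q, (∏ i, α (z i)) * Real.exp (t * (s * classDev α q z)) =
      ∏ i, (α (z i) * Real.exp (t * (s * ((if z i = q then 1 else 0) - α q)))) := fun z => by
    simp only [Finset.prod_mul_distrib, classDev, Finset.mul_sum, Real.exp_sum]
  have hq1 : α q ≤ 1 := hα1 ▸ Finset.single_le_sum (fun i _ => hα i) (Finset.mem_univ q)
  simp only [h1]
  rw [sum_labels_prod (fun _ a => α a * Real.exp (t * (s * ((if a = q then 1 else 0) - α q))))]
  have h2 := sum_mul_exp_le α (fun a => s * ((if a = q then 1 else 0) - α q)) hα hα1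
    (by
      have : ∀ a, α a * (s * ((if a = q then 1 else 0) - α q)) =
          s * (if a = q then α a else 0) - s * α q * α a := fun a => by
        split_ifs <;> ring
      simp only [this, Finset.sum_sub_distrib, ← Finset.mul_sum, hα1]
      simp)
    (fun a => by
      have := hα q
      rw [abs_mul, hs, one_mul, abs_le]
      split_ifs <;> constructor <;> linarith) ht0 ht1
  rw [Finset.prod_const, Finset.card_univ, Fintype.card_fin]
  refine (pow_le_pow_left₀ (Finset.sum_nonneg fun a _ =>
    mul_nonneg (hα a) (Real.exp_pos _).le) h2 n).trans_eq ?_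
  rw [← Real.exp_nat_mul]
  ring_nf

/-! ### Perturbation of the connection probabilities -/

/-- The gap that `ζ` leaves next to `0` and `1` freezes degenerate entries: a value within `e < ζ`
of `0` or `1` must equal it. The bound `e < 1` separates `0` from `1`. -/
lemma eq_or_mem_Icc_of_abs_sub_le {ζ e p p' : ℝ}
    (hp : p ∈ Set.Icc (0 : ℝ) 1 ∧ (p ∈ Set.Ioo (0 : ℝ) 1 → p ∈ Set.Icc ζ (1 - ζ)))
    (hp' : p' ∈ Set.Icc (0 : ℝ) 1 ∧ (p' ∈ Set.Ioo (0 : ℝ) 1 → p' ∈ Set.Icc ζ (1 - ζ)))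
    (heζ : e < ζ) (he1 : e < 1) (h : |p' - p| ≤ e) :
    (p' = p ∧ (p = 0 ∨ p = 1)) ∨ (p ∈ Set.Icc ζ (1 - ζ) ∧ p' ∈ Set.Icc ζ (1 - ζ)) := by
  obtain ⟨⟨h0, h1⟩, h2⟩ := hp
  obtain ⟨⟨h0', h1'⟩, h2'⟩ := hp'
  obtain ⟨ha, hb⟩ := abs_le.1 h
  rcases h0.eq_or_lt with h3 | h3
  · left
    refine ⟨?_, Or.inl h3.symm⟩
    by_contra h4
    have := (h2' ⟨lt_of_le_of_ne h0' fun h5 => h4 (h5.symm.trans h3), by linarith⟩).1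
    linarith
  rcases h1.eq_or_lt with h4 | h4
  · left
    refine ⟨?_, Or.inr h4⟩
    by_contra h5
    have := (h2' ⟨by linarith, lt_of_le_of_ne h1' fun h6 => h5 (h6.trans h4.symm)⟩).2
    linarith
  · have h5 := h2 ⟨h3, h4⟩
    exact Or.inr ⟨h5, h2' ⟨by linarith [h5.1], by linarith [h5.2]⟩⟩

lemma bern_le_mul_exp {ζ e p p' : ℝ} (hζ : 0 < ζ)
    (hp : p ∈ Set.Icc (0 : ℝ) 1 ∧ (p ∈ Set.Ioo (0 : ℝ) 1 → p ∈ Set.Icc ζ (1 - ζ)))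
    (hp' : p' ∈ Set.Icc (0 : ℝ) 1 ∧ (p' ∈ Set.Ioo (0 : ℝ) 1 → p' ∈ Set.Icc ζ (1 - ζ)))
    (he0 : 0 ≤ e) (heζ : e < ζ) (he1 : e < 1) (h : |p' - p| ≤ e) (b : Bool) :
    bern p' b ≤ bern p b * Real.exp (e / ζ) := by
  rcases eq_or_mem_Icc_of_abs_sub_le hp hp' heζ he1 h with ⟨h1, -⟩ | ⟨h1, h2⟩
  · rw [h1]
    exact le_mul_of_one_le_right (bern_nonneg hp.1 b) (Real.one_le_exp (by positivity))
  · have h3 : ζ ≤ bern p b ∧ bern p' b ≤ bern p b + e := by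
      obtain ⟨ha, hb⟩ := abs_le.1 h
      cases b
      · simp only [bern, Bool.false_eq_true, if_false]
        constructor <;> linarith [h1.2]
      · simp only [bern, if_true]
        constructor <;> linarith [h1.1]
    have h4 : e ≤ bern p b * (e / ζ) := by
      rw [mul_div_assoc', le_div_iff₀ hζ]
      nlinarith [h3.1]
    calc bern p' b ≤ bern p b * (e / ζ + 1) := by linarith [h3.2]
      _ ≤ _ := mul_le_mul_of_nonneg_left (Real.add_one_le_exp _) (hζ.le.trans h3.1)

/-- By `1 + y ≤ exp y` the exponent `(u - v) / v` suffices; replacing its denominator by `w` costs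
`(u - v) (w - v) / (v w)`, a second-order term. -/
lemma le_mul_exp_sub_div {ζ e u v w : ℝ} (hζ : 0 < ζ) (hv : ζ ≤ v) (hw : ζ ≤ w)
    (hu' : |u - w| ≤ e) (hv' : |v - w| ≤ e) :
    u ≤ v * Real.exp ((u - v) / w + 2 * e ^ 2 / ζ ^ 2) := by
  have hv0 := hζ.trans_le hv
  have hw0 := hζ.trans_le hw
  have he : 0 ≤ e := (abs_nonneg _).trans hu'
  have h1 : (u - v) / v - (u - v) / w ≤ 2 * e ^ 2 / ζ ^ 2 := by
    have h2 : (u - v) / v - (u - v) / w = (u - v) * (w - v) / (v * w) := by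
      field_simp
    rw [h2]
    have h3 : (u - v) * (w - v) ≤ 2 * e ^ 2 := by
      have h4 : |u - v| ≤ 2 * e := by
        have := abs_sub_le u w v
        rw [abs_sub_comm w v] at this
        linarith
      calc (u - v) * (w - v) ≤ |(u - v) * (w - v)| := le_abs_self _
        _ = |u - v| * |v - w| := by rw [abs_mul, abs_sub_comm w v]
        _ ≤ 2 * e * e := mul_le_mul h4 hv' (abs_nonneg _) (by linarith)
        _ = _ := by ring
    have h5 : ζ ^ 2 ≤ v * w := by rw [sq]; exact mul_le_mul hv hw hζ.le hv0.le
    exact (div_le_div_of_nonneg_right h3 (by positivity)).trans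
      (div_le_div_of_nonneg_left (by positivity) (by positivity) h5)
  calc u = v * ((u - v) / v + 1) := by field_simp; ring
    _ ≤ v * Real.exp ((u - v) / v) :=
        mul_le_mul_of_nonneg_left (Real.add_one_le_exp _) hv0.le
    _ ≤ _ := mul_le_mul_of_nonneg_left (Real.exp_le_exp.2 (by linarith)) hv0.le

/-- The score is taken at the third parameter `p`, the truth in the application, because there it is
centred. -/
lemma bern_le_mul_exp_score {ζ e p p' p'' : ℝ} (hζ : 0 < ζ)
    (hp : p ∈ Set.Icc (0 : ℝ) 1 ∧ (p ∈ Set.Ioo (0 : ℝ) 1 → p ∈ Set.Icc ζ (1 - ζ)))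
    (hp' : p' ∈ Set.Icc (0 : ℝ) 1 ∧ (p' ∈ Set.Ioo (0 : ℝ) 1 → p' ∈ Set.Icc ζ (1 - ζ)))
    (hp'' : p'' ∈ Set.Icc (0 : ℝ) 1 ∧ (p'' ∈ Set.Ioo (0 : ℝ) 1 → p'' ∈ Set.Icc ζ (1 - ζ)))
    (heζ : e < ζ) (he1 : e < 1) (h' : |p' - p| ≤ e) (h'' : |p'' - p| ≤ e) (b : Bool) :
    bern p'' b ≤ bern p' b * Real.exp ((p'' - p') / (p * (1 - p)) *
      ((if b then 1 else 0) - p) + 2 * e ^ 2 / ζ ^ 2) := by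
  rcases eq_or_mem_Icc_of_abs_sub_le hp hp' heζ he1 h' with ⟨h1, hp01⟩ | ⟨h1, h2⟩
  · rcases eq_or_mem_Icc_of_abs_sub_le hp hp'' heζ he1 h'' with ⟨h3, -⟩ | ⟨h3, -⟩
    · rw [h1, h3]
      refine le_mul_of_one_le_right (bern_nonneg hp.1 b) (Real.one_le_exp ?_)
      simp only [sub_self, zero_div, zero_mul, zero_add]
      positivity
    · rcases hp01 with h4 | h4 <;> linarith [h3.1, h3.2]
  · have hp0 : 0 < p := hζ.trans_le h1.1
    have hq0 : 0 < 1 - p := hζ.trans_le (by linarith [h1.2])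
    cases b
    · have h3 := le_mul_exp_sub_div (u := 1 - p'') (v := 1 - p') (w := 1 - p) (e := e) hζ
        (by linarith [h2.2]) (by linarith [h1.2])
        (by rwa [sub_sub_sub_cancel_left, abs_sub_comm])
        (by rwa [sub_sub_sub_cancel_left, abs_sub_comm])
      have h4 : (p'' - p') / (p * (1 - p)) * (0 - p) = (1 - p'' - (1 - p')) / (1 - p) := by
        field_simp
        ring
      simpa only [bern, Bool.false_eq_true, if_false, h4] using h3
    · have h3 := le_mul_exp_sub_div (u := p'') (v := p') (w := p) (e := e) hζ
        h2.1 h1.1 h'' h'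
      have h4 : (p'' - p') / (p * (1 - p)) * (1 - p) = (p'' - p') / p := by
        field_simp
      simpa only [bern, if_true, h4] using h3

lemma prod_pairs_exp {n : ℕ} (g : Fin n → Fin n → ℝ) :
    ∏ i, ∏ j, Real.exp (g i j) = Real.exp (∑ i, ∑ j, g i j) := by
  simp only [Real.exp_sum]

/-- The scores of single pairs, grouped by the classes of their ends, add up to the `blockDev`. -/
lemma edgeLik_le_mul_exp_blockDev {Q n : ℕ} {ζ e : ℝ} {π π' π'' : Conn Q} (hζ : 0 < ζ)
    (hπ : TruncConn ζ π) (hπ' : TruncConn ζ π') (hπ'' : TruncConn ζ π'')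
    (heζ : e < ζ) (he1 : e < 1) (h' : ∀ q l, |π' q l - π q l| ≤ e)
    (h'' : ∀ q l, |π'' q l - π q l| ≤ e) (x : Graph n) (z : Fin n → Fin Q) :
    edgeLik π'' x z ≤ edgeLik π' x z * Real.exp (∑ q, ∑ l,
      (π'' q l - π' q l) / (π q l * (1 - π q l)) * blockDev π q l z x +
        n ^ 2 * (2 * e ^ 2 / ζ ^ 2)) := by
  set c : Fin Q → Fin Q → ℝ := fun q l => (π'' q l - π' q l) / (π q l * (1 - π q l)) with hc
  set g : Fin n → Fin n → ℝ := fun i j => (∑ q, ∑ l, c q l *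
    (if i ≠ j ∧ z i = q ∧ z j = l then (if x i j then 1 else 0) - π q l else 0)) +
      2 * e ^ 2 / ζ ^ 2 with hg
  have hgij : ∀ i j, i ≠ j → g i j = c (z i) (z j) *
      ((if x i j then 1 else 0) - π (z i) (z j)) + 2 * e ^ 2 / ζ ^ 2 := fun i j hij => by
    simp only [hg]
    rw [Fintype.sum_eq_single (z i), Fintype.sum_eq_single (z j)]
    · simp [hij]
    · intro l hl
      simp [Ne.symm hl]
    · intro q hq
      simp [Ne.symm hq]
  have hsum : ∑ i, ∑ j, g i j = ∑ q, ∑ l, c q l * blockDev π q l z x +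
      n ^ 2 * (2 * e ^ 2 / ζ ^ 2) := by
    simp only [hg, Finset.sum_add_distrib, blockDev, Finset.mul_sum]
    congr 1
    · calc _ = ∑ i, ∑ q, ∑ l, ∑ j, c q l *
            (if i ≠ j ∧ z i = q ∧ z j = l then (if x i j then 1 else 0) - π q l else 0) := by
            refine Finset.sum_congr rfl fun i _ => ?_
            rw [Finset.sum_comm]
            exact Finset.sum_congr rfl fun q _ => Finset.sum_comm
        _ = _ := by
            rw [Finset.sum_comm]
            exact Finset.sum_congr rfl fun q _ => Finset.sum_comm
    · simp
      ring
  rw [← hsum, ← prod_pairs_exp, edgeLik_eq_prod_bern, edgeLik_eq_prod_bern,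
    ← Finset.prod_mul_distrib]
  simp only [← Finset.prod_mul_distrib]
  have hnn : ∀ i j, 0 ≤ if i = j then 1 else bern (π'' (z i) (z j)) (x i j) := fun i j => by
    split_ifs
    · exact zero_le_one
    · exact bern_nonneg (hπ'' _ _).1 _
  refine Finset.prod_le_prod (fun i _ => Finset.prod_nonneg fun j _ => hnn i j) fun i _ =>
    Finset.prod_le_prod (fun j _ => hnn i j) fun j _ => ?_
  by_cases hij : i = j
  · rw [if_pos hij, if_pos hij, one_mul]
    refine Real.one_le_exp ?_
    simp only [hg, hij, ne_eq, not_true_eq_false, false_and, if_false, mul_zero,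
      Finset.sum_const_zero, zero_add]
    positivity
  · rw [if_neg hij, if_neg hij, hgij i j hij]
    exact bern_le_mul_exp_score hζ (hπ _ _) (hπ' _ _) (hπ'' _ _) heζ he1 (h' _ _) (h'' _ _) _

lemma edgeLik_le_mul_exp_of_abs_blockDev_le {Q n : ℕ} {ζ e D : ℝ} {π π' π'' : Conn Q}
    (hζ : 0 < ζ)
    (hπ : TruncConn ζ π) (hπ' : TruncConn ζ π') (hπ'' : TruncConn ζ π'')
    (he0 : 0 ≤ e) (heζ : e < ζ) (he1 : e < 1) (h' : ∀ q l, |π' q l - π q l| ≤ e)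
    (h'' : ∀ q l, |π'' q l - π q l| ≤ e) (x : Graph n) (z : Fin n → Fin Q)
    (hD : ∀ q l, |blockDev π q l z x| ≤ D) :
    edgeLik π'' x z ≤ edgeLik π' x z *
      Real.exp (Q ^ 2 * (2 * e / ζ ^ 2 * D) + n ^ 2 * (2 * e ^ 2 / ζ ^ 2)) := by
  refine (edgeLik_le_mul_exp_blockDev hζ hπ hπ' hπ'' heζ he1 h' h'' x z).trans ?_
  refine mul_le_mul_of_nonneg_left (Real.exp_le_exp.2 (add_le_add_left ?_ _))
    (edgeLik_nonneg (fun q l => (hπ' q l).1) x z)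
  have h1 : ∀ q l, |(π'' q l - π' q l) / (π q l * (1 - π q l))| ≤ 2 * e / ζ ^ 2 := by
    intro q l
    rcases eq_or_mem_Icc_of_abs_sub_le (hπ q l) (hπ' q l) heζ he1 (h' q l) with
      ⟨-, h2⟩ | ⟨h2, -⟩
    -- At a degenerate entry, division by zero makes the coefficient `0`.
    · have : π q l * (1 - π q l) = 0 := by rcases h2 with h2 | h2 <;> simp [h2]
      rw [this, div_zero, abs_zero]
      positivity
    · have h3 : ζ ^ 2 ≤ π q l * (1 - π q l) := by
        rw [sq]
        exact mul_le_mul h2.1 (by linarith [h2.2]) hζ.le (hζ.le.trans h2.1)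
      have h4 : |π'' q l - π' q l| ≤ 2 * e := by
        have := abs_sub_le (π'' q l) (π q l) (π' q l)
        rw [abs_sub_comm (π q l)] at this
        linarith [h' q l, h'' q l]
      have h5 : 0 < ζ ^ 2 := by positivity
      rw [abs_div, abs_of_nonneg (h5.le.trans h3)]
      exact (div_le_div_of_nonneg_right h4 (h5.le.trans h3)).trans
        (div_le_div_of_nonneg_left (by linarith) h5 h3)
  calc _ ≤ ∑ _q : Fin Q, ∑ _l : Fin Q, 2 * e / ζ ^ 2 * D := by
        refine Finset.sum_le_sum fun q _ => Finset.sum_le_sum fun l _ => ?_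
        refine (le_abs_self _).trans ?_
        rw [abs_mul]
        exact mul_le_mul (h1 q l) (hD q l) (abs_nonneg _) (by positivity)
    _ = _ := by
        simp
        ring

/-- Pairs on which `z` agrees with `σ(zs)` at both ends cancel exactly, as `σ` preserves `π`. Any
other pair costs `exp (2 e / ζ)`, one factor `exp (e / ζ)` for each labeling, and `m i + m j` bounds
its indicator. The product form avoids dividing by likelihoods that may vanish. -/
lemma edgeLik_mul_edgeLik_le {Q n : ℕ} {ζ e : ℝ} {π π' : Conn Q} (hζ : 0 < ζ)
    (hπ : TruncConn ζ π) (hπ' : TruncConn ζ π')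
    (he0 : 0 ≤ e) (heζ : e < ζ) (he1 : e < 1) (h' : ∀ q l, |π' q l - π q l| ≤ e)
    {σ : Equiv.Perm (Fin Q)} (hσ : σ ∈ invPerms π) (x : Graph n) (z zs : Fin n → Fin Q) :
    edgeLik π' x z * edgeLik π x zs ≤
      edgeLik (fun q l => π' (σ q) (σ l)) x zs * edgeLik π x z *
        Real.exp (4 * (e / ζ) * n * hammingDist z (fun i => σ (zs i))) := by
  set m : Fin n → ℝ := fun i => if z i ≠ σ (zs i) then 1 else 0 with hm
  set g : Fin n → Fin n → ℝ := fun i j => 2 * (e / ζ) * (m i + m j) with hg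
  have hm0 : ∀ i, 0 ≤ m i := fun i => by simp only [hm]; split_ifs <;> norm_num
  have hmsum : ∑ i, m i = hammingDist z (fun i => σ (zs i)) := by
    simp only [hm, hammingDist, Finset.sum_boole]
  have hsum : ∑ i, ∑ j, g i j = 4 * (e / ζ) * n * hammingDist z (fun i => σ (zs i)) := by
    simp only [hg, ← Finset.mul_sum, Finset.sum_add_distrib, Finset.sum_const, Finset.card_univ,
      Fintype.card_fin, hmsum, nsmul_eq_mul]
    ring
  have heζ0 : 0 ≤ e / ζ := by positivity
  rw [← hsum, ← prod_pairs_exp]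
  simp only [edgeLik_eq_prod_bern, ← Finset.prod_mul_distrib]
  have hnn : ∀ {ρ : Conn Q}, TruncConn ζ ρ → ∀ (y : Fin n → Fin Q) (i j : Fin n),
      0 ≤ if i = j then 1 else bern (ρ (y i) (y j)) (x i j) := fun hρ y i j => by
    split_ifs
    · exact zero_le_one
    · exact bern_nonneg (hρ _ _).1 _
  have hnn2 : ∀ i j, 0 ≤ (if i = j then 1 else bern (π' (z i) (z j)) (x i j)) *
      (if i = j then 1 else bern (π (zs i) (zs j)) (x i j)) := fun i j =>
    mul_nonneg (hnn hπ' z i j) (hnn hπ zs i j)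
  refine Finset.prod_le_prod (fun i _ => Finset.prod_nonneg fun j _ => hnn2 i j) fun i _ =>
    Finset.prod_le_prod (fun j _ => hnn2 i j) fun j _ => ?_
  have hgnn : 0 ≤ g i j := by
    simp only [hg]
    have := hm0 i
    have := hm0 j
    positivity
  by_cases hij : i = j
  · simp only [if_pos hij, one_mul]
    exact Real.one_le_exp hgnn
  simp only [if_neg hij]
  by_cases hzz : z i = σ (zs i) ∧ z j = σ (zs j)
  · rw [hzz.1, hzz.2, hσ]
    exact le_mul_of_one_le_right (mul_nonneg (bern_nonneg (hπ' _ _).1 _)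
      (bern_nonneg (hπ _ _).1 _)) (Real.one_le_exp hgnn)
  · have h1 := bern_le_mul_exp hζ (hπ (z i) (z j)) (hπ' (z i) (z j)) he0 heζ he1 (h' _ _) (x i j)
    have h2 := bern_le_mul_exp hζ (hπ' (σ (zs i)) (σ (zs j))) (hπ (σ (zs i)) (σ (zs j)))
      he0 heζ he1 (by rw [abs_sub_comm]; exact h' _ _) (x i j)
    rw [hσ] at h2
    have h3 : 1 ≤ m i + m j := by
      rw [not_and_or] at hzz
      rcases hzz with h | h
      · have : m i = 1 := by simp [hm, h]
        linarith [hm0 j]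
      · have : m j = 1 := by simp [hm, h]
        linarith [hm0 i]
    have h4 : e / ζ + e / ζ ≤ g i j := by
      simp only [hg]
      nlinarith
    have h5 := bern_nonneg (hπ' (σ (zs i)) (σ (zs j))).1 (x i j)
    have h6 := bern_nonneg (hπ (z i) (z j)).1 (x i j)
    calc _ ≤ (bern (π (z i) (z j)) (x i j) * Real.exp (e / ζ)) *
          (bern (π' (σ (zs i)) (σ (zs j))) (x i j) * Real.exp (e / ζ)) :=
          mul_le_mul h1 h2 (bern_nonneg (hπ _ _).1 _) (mul_nonneg h6 (Real.exp_pos _).le)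
      _ = bern (π' (σ (zs i)) (σ (zs j))) (x i j) * bern (π (z i) (z j)) (x i j) *
          Real.exp (e / ζ + e / ζ) := by rw [Real.exp_add]; ring
      _ ≤ _ := mul_le_mul_of_nonneg_left (Real.exp_le_exp.2 h4) (mul_nonneg h5 h6)

/-! ### Identifiability of the labels -/

/-- The pairs of vertices whose connection probabilities differ under `z` and `z'`. -/
def mismatch {Q n : ℕ} (π : Conn Q) (z z' : Fin n → Fin Q) : Finset (Fin n × Fin n) :=
  open Classical in
  Finset.univ.filter fun p => p.1 ≠ p.2 ∧ π (z p.1) (z p.2) ≠ π (z' p.1) (z' p.2)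

lemma mem_mismatch {Q n : ℕ} {π : Conn Q} {z z' : Fin n → Fin Q} {p : Fin n × Fin n} :
    p ∈ mismatch π z z' ↔ p.1 ≠ p.2 ∧ π (z p.1) (z p.2) ≠ π (z' p.1) (z' p.2) := by
  simp [mismatch]

/-- Only the diagonal, of size `n`, can fail to be a mismatch. -/
lemma card_mul_card_le_card_mismatch {Q n : ℕ} {π : Conn Q} {z z' : Fin n → Fin Q}
    (A B : Finset (Fin n)) (h : ∀ i ∈ A, ∀ j ∈ B, π (z i) (z j) ≠ π (z' i) (z' j)) :
    A.card * B.card ≤ (mismatch π z z').card + n := by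
  classical
  have h1 : A ×ˢ B ⊆ mismatch π z z' ∪ Finset.univ.diag := by
    rintro ⟨i, j⟩ hp
    obtain ⟨hi, hj⟩ := Finset.mem_product.1 hp
    by_cases hij : i = j
    · exact Finset.mem_union_right _ (by simp [hij])
    · exact Finset.mem_union_left _ (mem_mismatch.2 ⟨hij, h i hi j hj⟩)
  have h2 := (Finset.card_le_card h1).trans (Finset.card_union_le _ _)
  simpa [Finset.card_product, Finset.diag_card] using h2

/-- Double counting: a mismatched pair is counted at most once from each of its ends. -/
lemma sum_card_le_two_mul_card_mismatch {Q n : ℕ} {π : Conn Q} {z z' : Fin n → Fin Q}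
    (A : Finset (Fin n)) (G : Fin n → Finset (Fin n))
    (h : ∀ i ∈ A, (∀ j ∈ G i, (i, j) ∈ mismatch π z z') ∨
      ∀ j ∈ G i, (j, i) ∈ mismatch π z z') :
    ∑ i ∈ A, (G i).card ≤ 2 * (mismatch π z z').card := by
  classical
  have h1 : ∀ i ∈ A, (G i).card ≤ (∑ j, if (i, j) ∈ mismatch π z z' then 1 else 0) +
      ∑ j, if (j, i) ∈ mismatch π z z' then 1 else 0 := by
    intro i hi
    simp only [← Finset.card_filter]
    rcases h i hi with h2 | h2
    · exact le_add_right (Finset.card_le_card fun j hj => by simpa using h2 j hj)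
    · exact le_add_left (Finset.card_le_card fun j hj => by simpa using h2 j hj)
  have h3 : ∑ i, ∑ j, (if (i, j) ∈ mismatch π z z' then 1 else 0) = (mismatch π z z').card := by
    rw [← Fintype.sum_prod_type (fun p => if p ∈ mismatch π z z' then 1 else 0)]
    simp
  calc ∑ i ∈ A, (G i).card ≤ ∑ i, ((∑ j, if (i, j) ∈ mismatch π z z' then 1 else 0) +
        ∑ j, if (j, i) ∈ mismatch π z z' then 1 else 0) :=
        (Finset.sum_le_sum h1).trans (Finset.sum_le_univ_sum_of_nonneg fun _ => zero_le)
    _ = 2 * (mismatch π z z').card := by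
        rw [Finset.sum_add_distrib, h3, Finset.sum_comm, h3]
        ring

lemma exists_label_card_ge {Q n : ℕ} {s : ℝ} (hQ : 0 < Q) {z zs : Fin n → Fin Q} {q : Fin Q}
    (h : s ≤ (Finset.univ.filter fun i => zs i = q).card) :
    ∃ a, s / Q ≤ (Finset.univ.filter fun i => zs i = q ∧ z i = a).card := by
  by_contra! hlt
  have h1 : (Finset.univ.filter fun i => zs i = q).card =
      ∑ a, (Finset.univ.filter fun i => zs i = q ∧ z i = a).card := by
    rw [Finset.card_eq_sum_card_fiberwise (f := z) (t := Finset.univ) (fun _ _ => by simp)]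
    simp only [Finset.filter_filter]
  have : Nonempty (Fin Q) := ⟨q⟩
  have h2 : ∑ a, ((Finset.univ.filter fun i => zs i = q ∧ z i = a).card : ℝ) <
      ∑ _a : Fin Q, s / Q := Finset.sum_lt_sum_of_nonempty Finset.univ_nonempty fun a _ => hlt a
  rw [h1] at h
  push_cast at h
  have h3 : (Q : ℝ) * (s / Q) = s := by field_simp
  simp only [Finset.sum_const, Finset.card_univ, Fintype.card_fin, nsmul_eq_mul, h3] at h2
  linarith

/-- Labels far from the orbit of the labels `zs` under `invPerms π` change the law of many
edges. -/
lemma exists_invPerm_card_mismatch_ge {Q : ℕ} {π : Conn Q} (hA1 : DistinctClasses π)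
    (hQ : 0 < Q) {s : ℝ} (hs : 0 < s) :
    ∃ c : ℝ, 0 < c ∧ ∀ᶠ n : ℕ in atTop, ∀ zs : Fin n → Fin Q,
      (∀ q, s * n ≤ (Finset.univ.filter fun i => zs i = q).card) → ∀ z : Fin n → Fin Q,
        ∃ σ ∈ invPerms π, c * n * hammingDist z (fun i => σ (zs i)) ≤ (mismatch π z zs).card := by
  set η : ℝ := s / Q with hη
  have hη0 : 0 < η := by positivity
  refine ⟨min (η ^ 2 / 2) (η / 2), by positivity, ?_⟩
  -- From this threshold on, the diagonal loss `n` is at most `η ^ 2 * n ^ 2 / 2`.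
  filter_upwards [eventually_ge_atTop ⌈2 / η ^ 2⌉₊] with n hn zs hzs z
  have hn' : 2 / η ^ 2 ≤ (n : ℝ) := (Nat.le_ceil _).trans (by exact_mod_cast hn)
  rw [div_le_iff₀ (by positivity)] at hn'
  choose f hf using fun q => exists_label_card_ge (z := z) hQ (hzs q)
  have hf' : ∀ q, η * n ≤ (Finset.univ.filter fun i => zs i = q ∧ z i = f q).card := fun q => by
    have := hf q
    rwa [mul_div_right_comm] at this
  have hn0 : (0 : ℝ) ≤ n := Nat.cast_nonneg n
  -- `f q` is a label that `z` gives to a fraction at least `1 / Q` of the class `q`. Either `f`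
  -- preserves `π`, hence is a permutation by `hA1`, or one pair of blocks is mismatched altogether.
  by_cases hconf : ∀ q l, π (f q) (f l) = π q l
  · have hinj : Function.Injective f := by
      intro q q' hqq
      by_contra hne
      obtain ⟨l, hl | hl⟩ := hA1 q q' hne
      · exact hl (by rw [← hconf q l, hqq, hconf])
      · exact hl (by rw [← hconf l q, hqq, hconf])
    set σ : Equiv.Perm (Fin Q) := Equiv.ofBijective f (Finite.injective_iff_bijective.1 hinj)
    have hσf : ∀ q, σ q = f q := fun q => rfl
    refine ⟨σ, fun q l => hconf q l, ?_⟩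
    set A : Finset (Fin n) := Finset.univ.filter fun i => z i ≠ σ (zs i)
    -- Each misclassified `i` has a class `l` that tells its two labels apart; all `j` of class `l`
    -- with `z j = f l` then give a mismatch with `i`, in one of the two orders. Outside `A` the
    -- value of `l` is arbitrary.
    have hl : ∀ i, ∃ l, i ∈ A →
        (π (σ.symm (z i)) l ≠ π (zs i) l ∨ π l (σ.symm (z i)) ≠ π l (zs i)) := by
      intro i
      by_cases hi : i ∈ A
      · have : σ.symm (z i) ≠ zs i := fun h => by
          have h2 : z i ≠ σ (zs i) := by simpa [A] using hi
          exact h2 (by rw [← h, Equiv.apply_symm_apply])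
        obtain ⟨l, hl⟩ := hA1 _ _ this
        exact ⟨l, fun _ => hl⟩
      · exact ⟨zs i, fun h => absurd h hi⟩
    choose l hl using hl
    have hmis := sum_card_le_two_mul_card_mismatch (π := π) (z := z) (z' := zs) A
      (fun i => Finset.univ.filter fun j => zs j = l i ∧ z j = f (l i)) (by
        intro i hi
        have hzi : z i = f (σ.symm (z i)) := by rw [← hσf, Equiv.apply_symm_apply]
        have hne : ∀ j, zs j = l i ∧ z j = f (l i) → i ≠ j := by
          rintro j ⟨hj1, hj2⟩ rfl
          have h2 : z i ≠ σ (zs i) := by simpa [A] using hi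
          exact h2 (by rw [hσf, hj1, hj2])
        refine (hl i hi).imp (fun h j hj => ?_) fun h j hj => ?_
        · have hj' : zs j = l i ∧ z j = f (l i) := by simpa using hj
          refine mem_mismatch.2 ⟨hne j hj', ?_⟩
          simp only
          rw [hj'.1, hj'.2, hzi, hconf]
          exact h
        · have hj' : zs j = l i ∧ z j = f (l i) := by simpa using hj
          refine mem_mismatch.2 ⟨(hne j hj').symm, ?_⟩
          simp only
          rw [hj'.1, hj'.2, hzi, hconf]
          exact h)
    have hmis' : ∑ i ∈ A, ((Finset.univ.filter fun j => zs j = l i ∧ z j = f (l i)).card : ℝ) ≤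
        2 * (mismatch π z zs).card := by exact_mod_cast hmis
    have h3 : (A.card : ℝ) * (η * n) ≤ 2 * (mismatch π z zs).card := by
      refine le_trans ?_ hmis'
      rw [← nsmul_eq_mul]
      exact Finset.card_nsmul_le_sum _ _ _ fun i _ => hf' (l i)
    have h4 : hammingDist z (fun i => σ (zs i)) = A.card := rfl
    rw [h4]
    have h5 : min (η ^ 2 / 2) (η / 2) * n * A.card ≤ η / 2 * n * A.card := by
      gcongr
      exact min_le_right _ _
    linarith
  · push Not at hconf
    obtain ⟨q, l, hql⟩ := hconf
    -- Here the mismatches are of order `n ^ 2`, so the identity works because a Hamming distance is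
    -- at most `n`.
    refine ⟨1, fun _ _ => rfl, ?_⟩
    have h1 := card_mul_card_le_card_mismatch (π := π) (z := z) (z' := zs)
      (Finset.univ.filter fun i => zs i = q ∧ z i = f q)
      (Finset.univ.filter fun i => zs i = l ∧ z i = f l) (by
        intro i hi j hj
        simp only [Finset.mem_filter, Finset.mem_univ, true_and] at hi hj
        rw [hi.1, hi.2, hj.1, hj.2]
        exact hql)
    have h2 : η * n * (η * n) ≤ (mismatch π z zs).card + n := by
      refine (mul_le_mul (hf' q) (hf' l) (by positivity) (by positivity)).trans ?_
      exact_mod_cast h1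
    have h3 : (hammingDist z (fun i => (1 : Equiv.Perm (Fin Q)) (zs i)) : ℝ) ≤ n := by
      have := hammingDist_le_card_fintype (x := z) (y := fun i => (1 : Equiv.Perm (Fin Q)) (zs i))
      rw [Fintype.card_fin] at this
      exact_mod_cast this
    have h5 : min (η ^ 2 / 2) (η / 2) * n *
        hammingDist z (fun i => (1 : Equiv.Perm (Fin Q)) (zs i)) ≤ η ^ 2 / 2 * n * n := by
      gcongr
      exact min_le_left _ _
    nlinarith

/-! ### Deviations of block counts and class sizes -/

lemma IsSBM.tendsto_measure_zero {Q : ℕ} {Ω : Type*} [MeasurableSpace Ω] {P : Measure Ω}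
    {α : Mix Q} {π : Conn Q} {Z : ℕ → Ω → Fin Q} {X : ℕ → ℕ → Ω → Bool}
    (h : IsSBM P α π Z X) (hα : ∀ q, 0 ≤ α q) (hπ : ∀ q l, π q l ∈ Set.Icc (0 : ℝ) 1)
    (B : (n : ℕ) → (Fin n → Fin Q) → Graph n → Prop)
    (F : (n : ℕ) → (Fin n → Fin Q) → Graph n → ℝ)
    (hF : ∀ n z x, 0 ≤ F n z x) (hB : ∀ n z x, B n z x → 0 < graphProb π z x → 1 ≤ F n z x)
    (u : ℕ → ℝ) (hu : Tendsto u atTop (𝓝 0))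
    (hFu : ∀ᶠ n in atTop, ∑ z, (∏ i, α (z i)) * ∑ x, graphProb π z x * F n z x ≤ u n) :
    Tendsto (fun n => P {ω | B n (fun i : Fin n => Z i ω) (adj X n ω)}) atTop (𝓝 0) := by
  have h1 : Tendsto (fun n => ENNReal.ofReal (u n)) atTop (𝓝 0) := by
    simpa using ENNReal.tendsto_ofReal hu
  refine tendsto_of_tendsto_of_tendsto_of_le_of_le' tendsto_const_nhds h1
    (Eventually.of_forall fun _ => zero_le) ?_
  filter_upwards [hFu] with n hn
  exact (h.measure_le_of_one_le hα hπ (B n) (F n) (hF n) (hB n)).trans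
    (ENNReal.ofReal_le_ofReal hn)

lemma sum_prod_labels {Q n : ℕ} {α : Mix Q} (hα1 : ∑ q, α q = 1) :
    ∑ z : Fin n → Fin Q, ∏ i, α (z i) = 1 := by
  rw [sum_labels_prod (fun _ => α)]
  simp [hα1]

lemma tendsto_exp_neg_mul {c : ℝ} (hc : 0 < c) :
    Tendsto (fun n : ℕ => Real.exp (-(c * n))) atTop (𝓝 0) :=
  Real.tendsto_exp_neg_atTop_nhds_zero.comp (tendsto_natCast_atTop_atTop.const_mul_atTop hc)

/-- Two-sided Chernoff bound at `t = η / 2`, which maximizes `η t - t ^ 2` and leaves the exponent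
`η ^ 2 / 4`. -/
lemma one_le_exp_add_exp_of_lt_abs {η y m : ℝ} (hη : 0 ≤ η) (h : η * m < |y|) :
    1 ≤ Real.exp (-(η ^ 2 / 2 * m)) *
      (Real.exp (η / 2 * (1 * y)) + Real.exp (η / 2 * (-1 * y))) := by
  rw [mul_add, ← Real.exp_add, ← Real.exp_add]
  rcases lt_abs.1 h with h1 | h1
  · have : 1 ≤ Real.exp (-(η ^ 2 / 2 * m) + η / 2 * (1 * y)) :=
      Real.one_le_exp (by nlinarith)
    linarith [Real.exp_pos (-(η ^ 2 / 2 * m) + η / 2 * (-1 * y))]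
  · have : 1 ≤ Real.exp (-(η ^ 2 / 2 * m) + η / 2 * (-1 * y)) :=
      Real.one_le_exp (by nlinarith)
    linarith [Real.exp_pos (-(η ^ 2 / 2 * m) + η / 2 * (1 * y))]

lemma IsSBM.tendsto_blockDev {Q : ℕ} {Ω : Type*} [MeasurableSpace Ω] {P : Measure Ω}
    {α : Mix Q} {π : Conn Q} {Z : ℕ → Ω → Fin Q} {X : ℕ → ℕ → Ω → Bool}
    (h : IsSBM P α π Z X) (hα : ∀ q, 0 ≤ α q) (hα1 : ∑ q, α q = 1)
    (hπ : ∀ q l, π q l ∈ Set.Icc (0 : ℝ) 1) {η : ℝ} (hη : 0 < η) (hη1 : η ≤ 1) (q l : Fin Q) :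
    Tendsto (fun n : ℕ => P {ω | η * (n : ℝ) ^ 2 <
      |blockDev π q l (fun i : Fin n => Z i ω) (adj X n ω)|}) atTop (𝓝 0) := by
  refine h.tendsto_measure_zero hα hπ (fun n z x => η * (n : ℝ) ^ 2 < |blockDev π q l z x|)
    (fun n z x => Real.exp (-(η ^ 2 / 2 * (n : ℝ) ^ 2)) *
      (Real.exp (η / 2 * (1 * blockDev π q l z x)) +
        Real.exp (η / 2 * (-1 * blockDev π q l z x))))
    (fun n z x => by positivity) (fun n z x hzx _ => one_le_exp_add_exp_of_lt_abs hη.le hzx)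
    (fun n => 2 * Real.exp (-(η ^ 2 / 4 * n)))
    (by simpa using (tendsto_exp_neg_mul (c := η ^ 2 / 4) (by positivity)).const_mul 2)
    (Eventually.of_forall fun n => ?_)
  have h1 : ∀ z : Fin n → Fin Q, ∑ x, graphProb π z x * (Real.exp (-(η ^ 2 / 2 * (n : ℝ) ^ 2)) *
      (Real.exp (η / 2 * (1 * blockDev π q l z x)) +
        Real.exp (η / 2 * (-1 * blockDev π q l z x)))) ≤
      2 * Real.exp (-(η ^ 2 / 4 * n)) := fun z => by
    have ha := sum_graphProb_mul_exp_blockDev hπ q l z (s := 1) (t := η / 2) (by simp)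
      (by linarith) (by linarith)
    have hb := sum_graphProb_mul_exp_blockDev hπ q l z (s := -1) (t := η / 2) (by simp)
      (by linarith) (by linarith)
    have hn : (n : ℝ) ≤ (n : ℝ) ^ 2 := by
      exact_mod_cast Nat.le_self_pow two_ne_zero n
    calc _ = Real.exp (-(η ^ 2 / 2 * (n : ℝ) ^ 2)) *
          (∑ x, graphProb π z x * Real.exp (η / 2 * (1 * blockDev π q l z x)) +
            ∑ x, graphProb π z x * Real.exp (η / 2 * (-1 * blockDev π q l z x))) := by
          rw [← Finset.sum_add_distrib, Finset.mul_sum]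
          exact Finset.sum_congr rfl fun x _ => by ring_nf
      _ ≤ Real.exp (-(η ^ 2 / 2 * (n : ℝ) ^ 2)) * (2 * Real.exp ((η / 2) ^ 2 * (n : ℝ) ^ 2)) :=
          mul_le_mul_of_nonneg_left (by linarith) (Real.exp_pos _).le
      _ = 2 * Real.exp (-(η ^ 2 / 4 * (n : ℝ) ^ 2)) := by
          rw [mul_left_comm, ← Real.exp_add]
          ring_nf
      _ ≤ _ := by gcongr
  calc _ ≤ ∑ z : Fin n → Fin Q, (∏ i, α (z i)) * (2 * Real.exp (-(η ^ 2 / 4 * n))) :=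
        Finset.sum_le_sum fun z _ =>
          mul_le_mul_of_nonneg_left (h1 z) (Finset.prod_nonneg fun i _ => hα _)
    _ = _ := by rw [← Finset.sum_mul, sum_prod_labels hα1, one_mul]

lemma IsSBM.tendsto_classDev {Q : ℕ} {Ω : Type*} [MeasurableSpace Ω] {P : Measure Ω}
    {α : Mix Q} {π : Conn Q} {Z : ℕ → Ω → Fin Q} {X : ℕ → ℕ → Ω → Bool}
    (h : IsSBM P α π Z X) (hα : ∀ q, 0 ≤ α q) (hα1 : ∑ q, α q = 1)
    (hπ : ∀ q l, π q l ∈ Set.Icc (0 : ℝ) 1) {η : ℝ} (hη : 0 < η) (hη1 : η ≤ 1) (q : Fin Q) :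
    Tendsto (fun n : ℕ => P {ω | η * n < |classDev α q (fun i : Fin n => Z i ω)|})
      atTop (𝓝 0) := by
  refine h.tendsto_measure_zero hα hπ (fun n z _ => η * n < |classDev α q z|)
    (fun n z _ => Real.exp (-(η ^ 2 / 2 * n)) *
      (Real.exp (η / 2 * (1 * classDev α q z)) + Real.exp (η / 2 * (-1 * classDev α q z))))
    (fun n z x => by positivity) (fun n z x hzx _ => one_le_exp_add_exp_of_lt_abs hη.le hzx)
    (fun n => 2 * Real.exp (-(η ^ 2 / 4 * n)))
    (by simpa using (tendsto_exp_neg_mul (c := η ^ 2 / 4) (by positivity)).const_mul 2)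
    (Eventually.of_forall fun n => ?_)
  simp only [← Finset.sum_mul, sum_graphProb, one_mul]
  have ha := sum_labels_mul_exp_classDev (n := n) hα hα1 q (s := 1) (t := η / 2) (by simp)
      (by linarith) (by linarith)
  have hb := sum_labels_mul_exp_classDev (n := n) hα hα1 q (s := -1) (t := η / 2) (by simp)
      (by linarith) (by linarith)
  calc _ = Real.exp (-(η ^ 2 / 2 * n)) *
        (∑ z : Fin n → Fin Q, (∏ i, α (z i)) * Real.exp (η / 2 * (1 * classDev α q z)) +
          ∑ z : Fin n → Fin Q, (∏ i, α (z i)) * Real.exp (η / 2 * (-1 * classDev α q z))) := by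
        rw [← Finset.sum_add_distrib, Finset.mul_sum]
        exact Finset.sum_congr rfl fun x _ => by ring_nf
    _ ≤ Real.exp (-(η ^ 2 / 2 * n)) * (2 * Real.exp ((η / 2) ^ 2 * n)) :=
        mul_le_mul_of_nonneg_left (by linarith) (Real.exp_pos _).le
    _ = _ := by
        rw [mul_left_comm, ← Real.exp_add]
        ring_nf

/-! ### Likelihood ratios of the labels -/

/-- One minus the left side is half the squared Hellinger distance of the two Bernoulli laws. -/
lemma sqrt_mul_add_sqrt_mul_lt_one {p p' : ℝ} (hp : p ∈ Set.Icc (0 : ℝ) 1)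
    (hp' : p' ∈ Set.Icc (0 : ℝ) 1) (h : p ≠ p') :
    √(p * p') + √((1 - p) * (1 - p')) < 1 := by
  have h1 : 0 ≤ 1 - p := by linarith [hp.2]
  have h2 : 0 ≤ 1 - p' := by linarith [hp'.2]
  rw [Real.sqrt_mul hp.1, Real.sqrt_mul h1]
  have h3 : √p - √p' ≠ 0 := fun h4 => h ((Real.sqrt_inj hp.1 hp'.1).1 (sub_eq_zero.1 h4))
  nlinarith [Real.sq_sqrt hp.1, Real.sq_sqrt hp'.1, Real.sq_sqrt h1, Real.sq_sqrt h2,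
    sq_nonneg (√(1 - p) - √(1 - p')), pow_pos (abs_pos.2 h3) 2, sq_abs (√p - √p')]

/-- There are finitely many pairs of entries, so any small enough `κ > 0` serves them all. -/
lemma exists_affinity_le {Q : ℕ} {π : Conn Q} (hπ : ∀ q l, π q l ∈ Set.Icc (0 : ℝ) 1) :
    ∃ κ : ℝ, 0 < κ ∧ ∀ q l q' l', π q l ≠ π q' l' →
      √(π q l * π q' l') + √((1 - π q l) * (1 - π q' l')) ≤ Real.exp (-κ) := by
  have hlim : Tendsto (fun κ : ℝ => Real.exp (-κ)) (𝓝[>] 0) (𝓝 1) := by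
    have : ContinuousAt (fun κ : ℝ => Real.exp (-κ)) 0 := by fun_prop
    simpa using this.tendsto.mono_left nhdsWithin_le_nhds
  have h1 : ∀ᶠ κ in 𝓝[>] (0 : ℝ), ∀ q l q' l', π q l ≠ π q' l' →
      √(π q l * π q' l') + √((1 - π q l) * (1 - π q' l')) ≤ Real.exp (-κ) := by
    simp only [eventually_all]
    intro q l q' l' hne
    filter_upwards [hlim.eventually_const_lt
      (sqrt_mul_add_sqrt_mul_lt_one (hπ q l) (hπ q' l') hne)] with κ hκ
    exact hκ.le
  obtain ⟨κ, hκ, hκ0⟩ := (h1.and self_mem_nhdsWithin).exists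
  exact ⟨κ, hκ0, hκ⟩

lemma sqrt_graphProb {Q n : ℕ} {π : Conn Q} (hπ : ∀ q l, π q l ∈ Set.Icc (0 : ℝ) 1)
    (z zs : Fin n → Fin Q) (x : Graph n) :
    √(graphProb π z x * graphProb π zs x) = ∏ i, ∏ j, if i = j then (if x i j then 0 else 1) else
      √(bern (π (z i) (z j)) (x i j) * bern (π (zs i) (zs j)) (x i j)) := by
  have h0 : 0 ≤ ∏ i, ∏ j, if i = j then (if x i j then (0 : ℝ) else 1) else
      √(bern (π (z i) (z j)) (x i j) * bern (π (zs i) (zs j)) (x i j)) := by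
    refine Finset.prod_nonneg fun i _ => Finset.prod_nonneg fun j _ => ?_
    split_ifs
    · exact le_rfl
    · exact zero_le_one
    · exact Real.sqrt_nonneg _
  rw [Real.sqrt_eq_iff_mul_self_eq (mul_nonneg (graphProb_nonneg hπ _ _)
    (graphProb_nonneg hπ _ _)) h0, graphProb, graphProb]
  simp only [← Finset.prod_mul_distrib]
  refine Finset.prod_congr rfl fun i _ => Finset.prod_congr rfl fun j _ => ?_
  split_ifs
  · simp
  · simp
  · rw [Real.mul_self_sqrt (mul_nonneg (bern_nonneg (hπ _ _) _) (bern_nonneg (hπ _ _) _))]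

/-- The affinity of product laws factorizes: each mismatch gives at most `exp (-κ)`, every other
pair gives `1`. -/
lemma sum_sqrt_graphProb_le {Q n : ℕ} {π : Conn Q} (hπ : ∀ q l, π q l ∈ Set.Icc (0 : ℝ) 1)
    {κ : ℝ} (hκ : ∀ q l q' l', π q l ≠ π q' l' →
      √(π q l * π q' l') + √((1 - π q l) * (1 - π q' l')) ≤ Real.exp (-κ))
    (z zs : Fin n → Fin Q) :
    ∑ x, √(graphProb π z x * graphProb π zs x) ≤
      Real.exp (-(κ * (mismatch π z zs).card)) := by
  simp only [sqrt_graphProb hπ]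
  rw [sum_graph_prod (fun i j b => if i = j then (if b then 0 else 1) else
      √(bern (π (z i) (z j)) b * bern (π (zs i) (zs j)) b))]
  set g : Fin n → Fin n → ℝ := fun i j => if (i, j) ∈ mismatch π z zs then -κ else 0 with hg
  have hsum : ∑ i, ∑ j, g i j = -(κ * (mismatch π z zs).card) := by
    simp only [hg]
    rw [← Fintype.sum_prod_type (fun p => if p ∈ mismatch π z zs then -κ else 0)]
    simp [mul_comm]
  rw [← hsum, ← prod_pairs_exp]
  have hnn : ∀ i j b, 0 ≤ if i = j then (if b then (0 : ℝ) else 1) else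
      √(bern (π (z i) (z j)) b * bern (π (zs i) (zs j)) b) := fun i j b => by
    split_ifs
    · exact le_rfl
    · exact zero_le_one
    · exact Real.sqrt_nonneg _
  refine Finset.prod_le_prod
    (fun i _ => Finset.prod_nonneg fun j _ => add_nonneg (hnn i j true) (hnn i j false))
    fun i _ => Finset.prod_le_prod (fun j _ => add_nonneg (hnn i j true) (hnn i j false))
    fun j _ => ?_
  by_cases hij : i = j
  · have : (i, j) ∉ mismatch π z zs := fun hm => (mem_mismatch.1 hm).1 hij
    simp [hg, this, if_pos hij]
  · by_cases hne : π (z i) (z j) = π (zs i) (zs j)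
    · have hnm : (i, j) ∉ mismatch π z zs := fun hm => (mem_mismatch.1 hm).2 hne
      have h0 := hπ (zs i) (zs j)
      simp only [hg, hnm, hij, if_false, hne, bern, if_true, Bool.false_eq_true, Real.exp_zero,
        Real.sqrt_mul_self h0.1, Real.sqrt_mul_self (sub_nonneg.2 h0.2)]
      linarith
    · have hm : (i, j) ∈ mismatch π z zs := mem_mismatch.2 ⟨hij, hne⟩
      simpa [hg, hm, hij, bern] using hκ _ _ _ _ hne

lemma sum_pow_hammingDist_le {Q n : ℕ} {t : ℝ} (ht : 0 ≤ t) (w : Fin n → Fin Q) :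
    ∑ z : Fin n → Fin Q, t ^ hammingDist z w ≤ (1 + Q * t) ^ n := by
  have h1 : ∀ z : Fin n → Fin Q, t ^ hammingDist z w = ∏ i, if z i ≠ w i then t else 1 :=
    fun z => by
      rw [Finset.prod_ite]
      simp [hammingDist]
  simp only [h1]
  rw [sum_labels_prod (fun i q => if q ≠ w i then t else 1)]
  calc _ ≤ ∏ _i : Fin n, (1 + Q * t) := by
        refine Finset.prod_le_prod (fun i _ => Finset.sum_nonneg fun q _ => ?_) fun i _ => ?_
        · split_ifs
          · exact ht
          · exact zero_le_one
        · calc _ ≤ ∑ q, ((if q = w i then 1 else 0) + t) := by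
                refine Finset.sum_le_sum fun q _ => ?_
                by_cases hq : q = w i <;> simp [hq, ht]
            _ = _ := by simp [Finset.sum_add_distrib]
    _ = _ := by simp

/-- The likelihood of the labels `z` that differ from `zs` on many edges, weighted by a power of
their distances to the relabelings of `zs`. -/
def farLik {Q n : ℕ} (c a : ℝ) (π : Conn Q) (zs : Fin n → Fin Q) (x : Graph n) : ℝ :=
  open Classical in
  ∑ σ : Equiv.Perm (Fin Q), ∑ z : Fin n → Fin Q,
    if c * n * hammingDist z (fun i => σ (zs i)) ≤ (mismatch π z zs).card then
      edgeLik π x z * (a ^ hammingDist z (fun i => σ (zs i))) ^ 2 else 0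

/-- The Hellinger version of `farLik`. -/
def farSqrt {Q n : ℕ} (c a : ℝ) (π : Conn Q) (zs : Fin n → Fin Q) (x : Graph n) : ℝ :=
  open Classical in
  ∑ σ : Equiv.Perm (Fin Q), ∑ z : Fin n → Fin Q,
    if c * n * hammingDist z (fun i => σ (zs i)) ≤ (mismatch π z zs).card then
      √(graphProb π z x / graphProb π zs x) * a ^ hammingDist z (fun i => σ (zs i)) else 0

lemma farSqrt_nonneg {Q n : ℕ} {c a : ℝ} (ha : 0 ≤ a) (π : Conn Q) (zs : Fin n → Fin Q)
    (x : Graph n) : 0 ≤ farSqrt c a π zs x := by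
  refine Finset.sum_nonneg fun σ _ => Finset.sum_nonneg fun z _ => ?_
  split_ifs
  · positivity
  · exact le_rfl

/-- A sum of squares of nonnegative numbers is at most the square of their sum. Square roots are
needed because a plain likelihood ratio can have mean `1`, with no decay. -/
lemma farLik_le_mul_sq {Q n : ℕ} {c a : ℝ} (ha : 0 ≤ a) {π : Conn Q}
    (hπ : ∀ q l, π q l ∈ Set.Icc (0 : ℝ) 1) {zs : Fin n → Fin Q} {x : Graph n}
    (hx : 0 < graphProb π zs x) :
    farLik c a π zs x ≤ edgeLik π x zs * farSqrt c a π zs x ^ 2 := by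
  classical
  have hl := loopless_of_graphProb_ne_zero hx.ne'
  set f : Equiv.Perm (Fin Q) × (Fin n → Fin Q) → ℝ := fun k =>
    if c * n * hammingDist k.2 (fun i => k.1 (zs i)) ≤ (mismatch π k.2 zs).card then
      √(graphProb π k.2 x / graphProb π zs x) * a ^ hammingDist k.2 (fun i => k.1 (zs i))
    else 0 with hf
  have hf0 : ∀ k, 0 ≤ f k := fun k => by
    simp only [hf]
    split_ifs
    · positivity
    · exact le_rfl
  have h1 : farSqrt c a π zs x = ∑ k, f k := by
    rw [Fintype.sum_prod_type]
    rfl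
  have h2 : farLik c a π zs x = edgeLik π x zs * ∑ k, f k ^ 2 := by
    rw [Fintype.sum_prod_type, Finset.mul_sum, farLik]
    refine Finset.sum_congr rfl fun σ _ => ?_
    rw [Finset.mul_sum]
    refine Finset.sum_congr rfl fun z _ => ?_
    simp only [hf]
    split_ifs
    · rw [mul_pow, Real.sq_sqrt (div_nonneg (graphProb_nonneg hπ _ _) hx.le),
        graphProb_eq_edgeLik π z hl, graphProb_eq_edgeLik π zs hl]
      rw [graphProb_eq_edgeLik π zs hl] at hx
      field_simp
    · simp
  rw [h1, h2]
  exact mul_le_mul_of_nonneg_left (Finset.sum_sq_le_sq_sum_of_nonneg fun k _ => hf0 k)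
    (edgeLik_nonneg hπ x zs)

/-- Far labels have affinity at most `exp (-κ c n r)`, so summing over `z` gives a generating
function of Hamming distances. The factorial factor comes from summing over all permutations. -/
lemma sum_graphProb_mul_farSqrt_le {Q n : ℕ} {c a κ : ℝ} (ha : 0 ≤ a) (hκ0 : 0 ≤ κ)
    {π : Conn Q} (hπ : ∀ q l, π q l ∈ Set.Icc (0 : ℝ) 1)
    (hκ : ∀ q l q' l', π q l ≠ π q' l' →
      √(π q l * π q' l') + √((1 - π q l) * (1 - π q' l')) ≤ Real.exp (-κ))
    (zs : Fin n → Fin Q) :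
    ∑ x, graphProb π zs x * farSqrt c a π zs x ≤
      Fintype.card (Equiv.Perm (Fin Q)) * (1 + Q * (a * Real.exp (-(κ * c * n)))) ^ n := by
  classical
  set t : ℝ := a * Real.exp (-(κ * c * n)) with ht
  have ht0 : 0 ≤ t := by positivity
  have hsq : ∀ (z : Fin n → Fin Q) x, graphProb π zs x * √(graphProb π z x / graphProb π zs x) ≤
      √(graphProb π z x * graphProb π zs x) := fun z x => by
    refine Real.le_sqrt_of_sq_le ?_
    rw [mul_pow, Real.sq_sqrt (div_nonneg (graphProb_nonneg hπ _ _) (graphProb_nonneg hπ _ _))]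
    rcases (graphProb_nonneg hπ zs x).eq_or_lt with h0 | h0
    · simp [← h0]
    · apply le_of_eq
      field_simp
  have hterm : ∀ (σ : Equiv.Perm (Fin Q)) (z : Fin n → Fin Q),
      ∑ x, graphProb π zs x *
        (if c * n * hammingDist z (fun i => σ (zs i)) ≤ (mismatch π z zs).card then
          √(graphProb π z x / graphProb π zs x) * a ^ hammingDist z (fun i => σ (zs i)) else 0) ≤
      t ^ hammingDist z (fun i => σ (zs i)) := fun σ z => by
    by_cases hc : c * n * hammingDist z (fun i => σ (zs i)) ≤ (mismatch π z zs).card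
    · simp only [if_pos hc, ← mul_assoc]
      rw [← Finset.sum_mul]
      calc _ ≤ Real.exp (-(κ * (mismatch π z zs).card)) *
            a ^ hammingDist z (fun i => σ (zs i)) :=
            mul_le_mul_of_nonneg_right ((Finset.sum_le_sum fun x _ => hsq z x).trans
              (sum_sqrt_graphProb_le hπ hκ z zs)) (by positivity)
        _ ≤ Real.exp (-(κ * c * n)) ^ hammingDist z (fun i => σ (zs i)) *
            a ^ hammingDist z (fun i => σ (zs i)) := by
            refine mul_le_mul_of_nonneg_right ?_ (by positivity)
            rw [← Real.exp_nat_mul]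
            refine Real.exp_le_exp.2 ?_
            nlinarith [mul_le_mul_of_nonneg_left hc hκ0]
        _ = _ := by rw [ht, mul_pow, mul_comm]
    · simp only [if_neg hc, mul_zero, Finset.sum_const_zero]
      positivity
  calc ∑ x, graphProb π zs x * farSqrt c a π zs x
      = ∑ σ : Equiv.Perm (Fin Q), ∑ z : Fin n → Fin Q, ∑ x, graphProb π zs x *
        (if c * n * hammingDist z (fun i => σ (zs i)) ≤ (mismatch π z zs).card then
          √(graphProb π z x / graphProb π zs x) * a ^ hammingDist z (fun i => σ (zs i))
            else 0) := by
        simp only [farSqrt, Finset.mul_sum]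
        rw [Finset.sum_comm]
        exact Finset.sum_congr rfl fun σ _ => Finset.sum_comm
    _ ≤ ∑ _σ : Equiv.Perm (Fin Q), (1 + Q * t) ^ n :=
        Finset.sum_le_sum fun σ _ => (Finset.sum_le_sum fun z _ => hterm σ z).trans
          (sum_pow_hammingDist_le ht0 _)
    _ = _ := by simp [Finset.card_univ]

lemma IsSBM.tendsto_farLik {Q : ℕ} {Ω : Type*} [MeasurableSpace Ω] {P : Measure Ω}
    {α : Mix Q} {π : Conn Q} {Z : ℕ → Ω → Fin Q} {X : ℕ → ℕ → Ω → Bool}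
    (h : IsSBM P α π Z X) (hα : ∀ q, 0 ≤ α q) (hα1 : ∑ q, α q = 1)
    (hπ : ∀ q l, π q l ∈ Set.Icc (0 : ℝ) 1) {c a δ : ℝ} (hc : 0 < c) (ha : 0 ≤ a) (hδ : 0 < δ) :
    Tendsto (fun n : ℕ => P {ω | Real.exp (δ * n) *
      edgeLik π (adj X n ω) (fun i : Fin n => Z i ω) <
        farLik c a π (fun i : Fin n => Z i ω) (adj X n ω)}) atTop (𝓝 0) := by
  obtain ⟨κ, hκ0, hκ⟩ := exists_affinity_le hπ
  set m : ℝ := (Fintype.card (Equiv.Perm (Fin Q)) : ℝ) with hm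
  refine h.tendsto_measure_zero hα hπ
    (fun n zs x => Real.exp (δ * n) * edgeLik π x zs < farLik c a π zs x)
    (fun n zs x => Real.exp (-(δ / 2 * n)) * farSqrt c a π zs x)
    (fun n z x => mul_nonneg (Real.exp_pos _).le (farSqrt_nonneg ha _ _ _))
    (fun n zs x hzx hx => ?_)
    (fun n => m * Real.exp (-(δ / 4 * n)))
    (by simpa using (tendsto_exp_neg_mul (c := δ / 4) (by positivity)).const_mul m) ?_
  · have h1 := hzx.trans_le (farLik_le_mul_sq ha hπ hx)
    have h2 : 0 < edgeLik π x zs := by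
      rwa [graphProb_eq_edgeLik π zs (loopless_of_graphProb_ne_zero hx.ne')] at hx
    rw [mul_comm] at h1
    have h3 := lt_of_mul_lt_mul_left h1 h2.le
    have h4 : Real.exp (δ / 2 * n) ^ 2 = Real.exp (δ * n) := by
      rw [← Real.exp_nat_mul]
      ring_nf
    rw [← h4] at h3
    have h5 := lt_of_pow_lt_pow_left₀ 2 (farSqrt_nonneg ha _ _ _) h3
    calc (1 : ℝ) = Real.exp (-(δ / 2 * n)) * Real.exp (δ / 2 * n) := by
          rw [← Real.exp_add]
          simp
      _ ≤ _ := mul_le_mul_of_nonneg_left h5.le (Real.exp_pos _).le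
  · have hlim : Tendsto (fun n : ℕ => Q * (a * Real.exp (-(κ * c * n)))) atTop (𝓝 0) := by
      simpa using ((tendsto_exp_neg_mul (mul_pos hκ0 hc)).const_mul a).const_mul (Q : ℝ)
    -- The base of the `n`-th power is then at most `1 + δ / 4 ≤ exp (δ / 4)`, while the threshold
    -- `exp (δ n)` has become `exp (δ n / 2)` under the square root.
    filter_upwards [hlim.eventually_le_const (show (0 : ℝ) < δ / 4 by positivity)] with n hn
    have h1 : ∀ zs : Fin n → Fin Q, ∑ x, graphProb π zs x *
        (Real.exp (-(δ / 2 * n)) * farSqrt c a π zs x) ≤ m * Real.exp (-(δ / 4 * n)) := fun zs => by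
      calc _ = Real.exp (-(δ / 2 * n)) * ∑ x, graphProb π zs x * farSqrt c a π zs x := by
            rw [Finset.mul_sum]
            exact Finset.sum_congr rfl fun x _ => by ring_nf
        _ ≤ Real.exp (-(δ / 2 * n)) * (m * Real.exp (δ / 4) ^ n) := by
            refine mul_le_mul_of_nonneg_left
              ((sum_graphProb_mul_farSqrt_le ha hκ0.le hπ hκ zs).trans ?_) (Real.exp_pos _).le
            refine mul_le_mul_of_nonneg_left (pow_le_pow_left₀ (by positivity) ?_ n)
              (Nat.cast_nonneg _)
            linarith [Real.add_one_le_exp (δ / 4)]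
        _ = _ := by
            rw [← Real.exp_nat_mul, mul_left_comm, ← Real.exp_add]
            ring_nf
    calc _ ≤ ∑ z : Fin n → Fin Q, (∏ i, α (z i)) * (m * Real.exp (-(δ / 4 * n))) :=
          Finset.sum_le_sum fun z _ =>
            mul_le_mul_of_nonneg_left (h1 z) (Finset.prod_nonneg fun i _ => hα _)
      _ = _ := by rw [← Finset.sum_mul, sum_prod_labels hα1, one_mul]

/-! ### From the likelihood to the group proportions -/

lemma prod_labels_le_mul_pow {Q n : ℕ} {γ : ℝ} {α : Mix Q} (hγ : 0 < γ) (hα : TruncMix γ α)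
    (z w : Fin n → Fin Q) :
    ∏ i, α (z i) ≤ (∏ i, α (w i)) * γ⁻¹ ^ hammingDist z w := by
  have h1 : γ⁻¹ ^ hammingDist z w = ∏ i, if z i ≠ w i then γ⁻¹ else 1 := by
    rw [Finset.prod_ite]
    simp [hammingDist]
  rw [h1, ← Finset.prod_mul_distrib]
  refine Finset.prod_le_prod (fun i _ => hγ.le.trans (hα.2 _).1) fun i _ => ?_
  by_cases h : z i = w i
  · simp [h]
  · rw [if_pos h, ← div_eq_mul_inv, le_div_iff₀ hγ]
    have h2 := hα.2 (z i)
    have h3 := hα.2 (w i)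
    nlinarith [h2.1, h2.2, h3.1]

/-- Each `z` is charged to the `σ` provided by `hident`. The factor `a ^ 2` pays, per misclassified
vertex, both for the change of `π` on its pairs and for the change of `α'`; the exponential pays for
undoing `σ` in `π'` at `zs`. -/
lemma lik_mul_edgeLik_le {Q n : ℕ} {ζ γ e c a D b : ℝ} {α' : Mix Q} {π π' : Conn Q}
    (hζ : 0 < ζ) (hγ : 0 < γ) (hπ : TruncConn ζ π) (hα' : TruncMix γ α') (hπ' : TruncConn ζ π')
    (he0 : 0 ≤ e) (heζ : e < ζ) (he1 : e < 1) (h' : ∀ q l, |π' q l - π q l| ≤ e)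
    {x : Graph n} {zs : Fin n → Fin Q}
    (hident : ∀ z : Fin n → Fin Q, ∃ σ ∈ invPerms π,
      c * n * hammingDist z (fun i => σ (zs i)) ≤ (mismatch π z zs).card)
    (hD : ∀ q l, |blockDev π q l zs x| ≤ D)
    (ha : Real.exp (4 * (e / ζ) * n) * γ⁻¹ ≤ a ^ 2)
    (hb : ∀ σ ∈ invPerms π, ∏ i, α' (σ (zs i)) ≤ b) (hb0 : 0 ≤ b) :
    lik α' π' x * edgeLik π x zs ≤ edgeLik π' x zs *
      Real.exp (Q ^ 2 * (2 * e / ζ ^ 2 * D) + n ^ 2 * (2 * e ^ 2 / ζ ^ 2)) * b *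
        farLik c a π zs x := by
  classical
  set A : ℝ := edgeLik π' x zs *
      Real.exp (Q ^ 2 * (2 * e / ζ ^ 2 * D) + n ^ 2 * (2 * e ^ 2 / ζ ^ 2)) * b with hA
  have hE : ∀ y, 0 ≤ edgeLik π x y := edgeLik_nonneg (fun q l => (hπ q l).1) x
  have hE' : ∀ y, 0 ≤ edgeLik π' x y := edgeLik_nonneg (fun q l => (hπ' q l).1) x
  have hA0 : 0 ≤ A := mul_nonneg (mul_nonneg (hE' zs) (Real.exp_pos _).le) hb0
  have hz : ∀ z : Fin n → Fin Q, jointLik α' π' x z * edgeLik π x zs ≤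
      A * ∑ σ : Equiv.Perm (Fin Q),
        if c * n * hammingDist z (fun i => σ (zs i)) ≤ (mismatch π z zs).card then
          edgeLik π x z * (a ^ hammingDist z (fun i => σ (zs i))) ^ 2 else 0 := by
    intro z
    obtain ⟨σ, hσ, hc⟩ := hident z
    set r := hammingDist z (fun i => σ (zs i)) with hr
    have h1 := edgeLik_mul_edgeLik_le hζ hπ hπ' he0 heζ he1 h' hσ x z zs
    have h2 := edgeLik_le_mul_exp_of_abs_blockDev_le (π'' := fun q l => π' (σ q) (σ l)) hζ hπ hπ'
      (fun q l => hπ' _ _) he0 heζ he1 h' (fun q l => by rw [← hσ q l]; exact h' _ _) x zs hD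
    have h3 := prod_labels_le_mul_pow hγ hα' z (fun i => σ (zs i))
    have h4 : Real.exp (4 * (e / ζ) * n * r) * γ⁻¹ ^ r ≤ (a ^ r) ^ 2 := by
      rw [mul_comm _ (r : ℝ), Real.exp_nat_mul, ← mul_pow, ← pow_mul, mul_comm r 2, pow_mul]
      exact pow_le_pow_left₀ (by positivity) ha r
    have h5 : edgeLik π x z * (a ^ r) ^ 2 ≤ ∑ σ : Equiv.Perm (Fin Q),
        if c * n * hammingDist z (fun i => σ (zs i)) ≤ (mismatch π z zs).card then
          edgeLik π x z * (a ^ hammingDist z (fun i => σ (zs i))) ^ 2 else 0 := by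
      refine le_trans (le_of_eq ?_) (Finset.single_le_sum (fun σ _ => ?_) (Finset.mem_univ σ))
      · rw [if_pos hc]
      · split_ifs
        · exact mul_nonneg (hE z) (sq_nonneg _)
        · exact le_rfl
    refine le_trans ?_ (mul_le_mul_of_nonneg_left h5 hA0)
    have hprod0 : 0 ≤ ∏ i, α' (z i) := Finset.prod_nonneg fun i _ => hγ.le.trans (hα'.2 _).1
    have hγr : 0 ≤ γ⁻¹ ^ hammingDist z (fun i => σ (zs i)) := by positivity
    calc jointLik α' π' x z * edgeLik π x zs
        = (edgeLik π' x z * edgeLik π x zs) * ∏ i, α' (z i) := by rw [jointLik]; ring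
      _ ≤ (edgeLik (fun q l => π' (σ q) (σ l)) x zs * edgeLik π x z *
            Real.exp (4 * (e / ζ) * n * r)) * (b * γ⁻¹ ^ r) := by
          refine mul_le_mul h1 (h3.trans (mul_le_mul_of_nonneg_right (hb σ hσ) hγr)) hprod0 ?_
          exact mul_nonneg (mul_nonneg (edgeLik_nonneg (fun q l => (hπ' _ _).1) x zs) (hE z))
            (Real.exp_pos _).le
      _ = edgeLik (fun q l => π' (σ q) (σ l)) x zs * (b * (edgeLik π x z *
            (Real.exp (4 * (e / ζ) * n * r) * γ⁻¹ ^ r))) := by ring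
      _ ≤ (edgeLik π' x zs *
            Real.exp (Q ^ 2 * (2 * e / ζ ^ 2 * D) + n ^ 2 * (2 * e ^ 2 / ζ ^ 2))) *
            (b * (edgeLik π x z * (a ^ r) ^ 2)) := by
          refine mul_le_mul h2 ?_ ?_ (mul_nonneg (hE' zs) (Real.exp_pos _).le)
          · exact mul_le_mul_of_nonneg_left (mul_le_mul_of_nonneg_left h4 (hE z)) hb0
          · exact mul_nonneg hb0 (mul_nonneg (hE z) (mul_nonneg (Real.exp_pos _).le hγr))
      _ = A * (edgeLik π x z * (a ^ r) ^ 2) := by rw [hA]; ring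
  rw [lik, Finset.sum_mul, farLik, Finset.sum_comm, Finset.mul_sum]
  exact Finset.sum_le_sum fun z _ => hz z

/-- With `σ` maximizing the product of proportions, the upper bound on the likelihood meets the
lower bound from the competitor, and `edgeLik π' x zs` cancels. -/
lemma exists_invPerm_prod_le {Q n : ℕ} {ζ γ e c a D E : ℝ} {α α' : Mix Q} {π π' : Conn Q}
    (hζ : 0 < ζ) (hγ : 0 < γ) (hα : TruncMix γ α) (hπ : TruncConn ζ π)
    (he0 : 0 ≤ e) (heζ : e < ζ) (he1 : e < 1) (h' : ∀ q l, |π' q l - π q l| ≤ e)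
    {x : Graph n} (hVE : IsVE ζ γ x α' π') {zs : Fin n → Fin Q} (hpos : 0 < edgeLik π x zs)
    (hident : ∀ z : Fin n → Fin Q, ∃ σ ∈ invPerms π,
      c * n * hammingDist z (fun i => σ (zs i)) ≤ (mismatch π z zs).card)
    (hD : ∀ q l, |blockDev π q l zs x| ≤ D)
    (ha : Real.exp (4 * (e / ζ) * n) * γ⁻¹ ≤ a ^ 2)
    (hfar : farLik c a π zs x ≤ E * edgeLik π x zs) :
    ∃ σ ∈ invPerms π, ∏ i, α (zs i) ≤
      Real.exp (Q ^ 2 * (2 * e / ζ ^ 2 * D) + n ^ 2 * (2 * e ^ 2 / ζ ^ 2)) * E *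
        ∏ i, α' (σ (zs i)) := by
  have hα' := hVE.1
  have hπ' := hVE.2.1
  obtain ⟨σ, hσ, hmax⟩ := Set.exists_max_image (invPerms π)
    (fun σ => ∏ i, α' (σ (zs i))) (Set.toFinite _) ⟨1, fun _ _ => rfl⟩
  refine ⟨σ, hσ, ?_⟩
  set B : ℝ := Real.exp (Q ^ 2 * (2 * e / ζ ^ 2 * D) + n ^ 2 * (2 * e ^ 2 / ζ ^ 2)) with hB
  set b : ℝ := ∏ i, α' (σ (zs i)) with hb
  have hb0 : 0 ≤ b := Finset.prod_nonneg fun i _ => hγ.le.trans (hα'.2 _).1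
  -- Comparing `π` with `π'` at `zs` transfers positivity to `π'`.
  have hE'0 : 0 < edgeLik π' x zs := by
    have h2 := edgeLik_le_mul_exp_of_abs_blockDev_le (π'' := π) hζ hπ hπ' hπ he0 heζ he1 h'
      (fun q l => by simpa using he0) x zs hD
    exact pos_of_mul_pos_left (hpos.trans_le h2) (Real.exp_pos _).le
  have h1 : lik α' π' x * edgeLik π x zs ≤
      (edgeLik π' x zs * B * b * E) * edgeLik π x zs := by
    refine (lik_mul_edgeLik_le hζ hγ hπ hα' hπ' he0 heζ he1 h' hident hD ha hmax hb0).trans ?_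
    refine (mul_le_mul_of_nonneg_left hfar
      (mul_nonneg (mul_nonneg hE'0.le (Real.exp_pos _).le) hb0)).trans_eq ?_
    ring
  have h2 := le_of_mul_le_mul_right h1 hpos
  have h3 : 0 < jointLik α π' x zs :=
    mul_pos hE'0 (Finset.prod_pos fun i _ => hγ.trans_le (hα.2 _).1)
  have h4 := (jointLik_le_lik_of_isVE hγ.le hVE hα zs h3).trans h2
  refine le_of_mul_le_mul_left (h4.trans_eq ?_) hE'0
  ring

lemma sum_labels_eq {Q n : ℕ} (α g : Mix Q) (z : Fin n → Fin Q) :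
    ∑ i, g (z i) = n * ∑ q, α q * g q + ∑ q, classDev α q z * g q := by
  have h1 : ∑ q, classDev α q z * g q = ∑ i, (g (z i) - ∑ q, α q * g q) := by
    simp only [classDev, Finset.sum_mul]
    rw [Finset.sum_comm]
    refine Finset.sum_congr rfl fun i _ => ?_
    simp only [sub_mul, Finset.sum_sub_distrib, ite_mul, one_mul, zero_mul]
    simp
  rw [h1, Finset.sum_sub_distrib]
  simp

/-- Applying `log y ≤ y - 1` to `√(β / α)` bounds the divergence below by the squared Hellinger
distance; then `√α + √β ≤ 2`. -/
lemma sq_sub_le_of_kl_le {Q : ℕ} {K : ℝ} {α β : Mix Q} (hα : ∀ q, 0 < α q ∧ α q ≤ 1)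
    (hβ : ∀ q, 0 < β q ∧ β q ≤ 1) (hα1 : ∑ q, α q = 1) (hβ1 : ∑ q, β q = 1)
    (h : ∑ q, α q * (Real.log (α q) - Real.log (β q)) ≤ K) (q : Fin Q) :
    (α q - β q) ^ 2 ≤ 4 * K := by
  have h1 : ∀ q, α q - β q + (√(α q) - √(β q)) ^ 2 ≤
      α q * (Real.log (α q) - Real.log (β q)) := fun q => by
    obtain ⟨ha, -⟩ := hα q
    obtain ⟨hb, -⟩ := hβ q
    have hsa := Real.sqrt_pos.2 ha
    have hsb := Real.sqrt_pos.2 hb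
    have h2 : Real.log (√(β q) / √(α q)) ≤ √(β q) / √(α q) - 1 :=
      Real.log_le_sub_one_of_pos (by positivity)
    rw [Real.log_div hsb.ne' hsa.ne', Real.log_sqrt ha.le, Real.log_sqrt hb.le] at h2
    have h3 : α q * (√(β q) / √(α q)) = √(α q) * √(β q) := by
      have : α q = √(α q) * √(α q) := (Real.mul_self_sqrt ha.le).symm
      nth_rewrite 1 [this]
      field_simp
    have h4 := mul_le_mul_of_nonneg_left h2 ha.le
    rw [mul_sub (α q) (√(β q) / √(α q)) 1, h3] at h4
    nlinarith [Real.sq_sqrt ha.le, Real.sq_sqrt hb.le]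
  have h2 : ∑ q, (√(α q) - √(β q)) ^ 2 ≤ K := by
    have h3 := Finset.sum_le_sum (s := Finset.univ) fun q _ => h1 q
    rw [Finset.sum_add_distrib, Finset.sum_sub_distrib, hα1, hβ1] at h3
    linarith
  have h3 : (√(α q) - √(β q)) ^ 2 ≤ K :=
    (Finset.single_le_sum (f := fun q => (√(α q) - √(β q)) ^ 2)
      (fun q _ => sq_nonneg _) (Finset.mem_univ q)).trans h2
  have h4 : α q - β q = (√(α q) - √(β q)) * (√(α q) + √(β q)) := by
    nlinarith [Real.sq_sqrt (hα q).1.le, Real.sq_sqrt (hβ q).1.le]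
  have h5 : √(α q) + √(β q) ≤ 2 := by
    have := Real.sqrt_le_one.2 (hα q).2
    have := Real.sqrt_le_one.2 (hβ q).2
    linarith
  have h6 : (√(α q) + √(β q)) ^ 2 ≤ 2 ^ 2 := pow_le_pow_left₀ (by positivity) h5 2
  rw [h4, mul_pow]
  nlinarith [mul_le_mul_of_nonneg_left h6 (sq_nonneg (√(α q) - √(β q)))]

/-- The log-ratio summed over the vertices is `n` times the divergence plus a fluctuation,
controlled by the class deviations since log-ratios are at most `-log γ` in absolute value. -/
lemma sq_sub_le_of_prod_le {Q n : ℕ} {γ η δ : ℝ} {α β : Mix Q} (hγ : 0 < γ) (hn : 0 < n)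
    (hα : TruncMix γ α) (hβ : TruncMix γ β) {z : Fin n → Fin Q}
    (hz : ∀ q, |classDev α q z| ≤ η * n)
    (h : ∏ i, α (z i) ≤ Real.exp (δ * n) * ∏ i, β (z i)) (q : Fin Q) :
    (α q - β q) ^ 2 ≤ 4 * (δ + Q * (η * -Real.log γ)) := by
  have hα0 : ∀ q, 0 < α q := fun q => hγ.trans_le (hα.2 q).1
  have hβ0 : ∀ q, 0 < β q := fun q => hγ.trans_le (hβ.2 q).1
  have hα1 : ∀ q, α q ≤ 1 := fun q => by linarith [(hα.2 q).2]
  have hβ1 : ∀ q, β q ≤ 1 := fun q => by linarith [(hβ.2 q).2]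
  refine sq_sub_le_of_kl_le (fun q => ⟨hα0 q, hα1 q⟩) (fun q => ⟨hβ0 q, hβ1 q⟩) hα.1 hβ.1 ?_ q
  set g : Mix Q := fun q => Real.log (α q) - Real.log (β q) with hg
  have hgb : ∀ q, |g q| ≤ -Real.log γ := fun q => by
    have ha := Real.log_le_log hγ (hα.2 q).1
    have hb := Real.log_le_log hγ (hβ.2 q).1
    have ha' := Real.log_nonpos (hα0 q).le (hα1 q)
    have hb' := Real.log_nonpos (hβ0 q).le (hβ1 q)
    rw [abs_le]
    constructor <;> simp only [hg] <;> linarith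
  have h1 : ∑ i, g (z i) ≤ δ * n := by
    have h2 := Real.log_le_log (Finset.prod_pos fun i _ => hα0 (z i)) h
    rw [Real.log_mul (Real.exp_pos _).ne' (Finset.prod_pos fun i _ => hβ0 (z i)).ne',
      Real.log_exp, Real.log_prod (fun i _ => (hα0 (z i)).ne'),
      Real.log_prod (fun i _ => (hβ0 (z i)).ne')] at h2
    simp only [hg, Finset.sum_sub_distrib]
    linarith
  rw [sum_labels_eq α g z] at h1
  have h2 : -(Q * (η * n * -Real.log γ)) ≤ ∑ q, classDev α q z * g q := by
    have : ∑ _q : Fin Q, -(η * n * -Real.log γ) ≤ ∑ q, classDev α q z * g q := by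
      refine Finset.sum_le_sum fun q _ => ?_
      refine le_trans ?_ (neg_abs_le _)
      rw [abs_mul]
      exact neg_le_neg (mul_le_mul (hz q) (hgb q) (abs_nonneg _)
        ((abs_nonneg _).trans (hz q)))
    simpa using this
  have hn' : (0 : ℝ) < n := by exact_mod_cast hn
  refine le_of_mul_le_mul_left ?_ hn'
  nlinarith

/-- A ball of `d` is open in the usual topology, so it contains a sup-norm ball. -/
lemma IsUsualDist.exists_forall_abs_sub_lt {Q : ℕ} {d : Mix Q → Mix Q → ℝ} (hd : IsUsualDist d)
    (α : Mix Q) {ε : ℝ} (hε : 0 < ε) :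
    ∃ s : ℝ, 0 < s ∧ ∀ β : Mix Q, (∀ q, |β q - α q| < s) → d β α ≤ ε := by
  obtain ⟨m, hm, hdm⟩ := hd
  have h1 : @IsOpen _ m.toUniformSpace.toTopologicalSpace {β | m.dist β α < ε} :=
    @Metric.isOpen_ball _ m.toPseudoMetricSpace α ε
  rw [hm] at h1
  have h2 : α ∈ {β | m.dist β α < ε} := by
    simpa [@dist_self _ m.toPseudoMetricSpace α] using hε
  obtain ⟨s, hs, hsub⟩ := Metric.isOpen_iff.1 h1 α h2
  refine ⟨s, hs, fun β hβ => ?_⟩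
  rw [hdm]
  exact le_of_lt (hsub (Metric.mem_ball.2 ((dist_pi_lt_iff hs).2 fun q => hβ q)))

/-! ### Typical graphs -/

/-- The events on which the variational estimator of the group proportions is controlled. -/
structure Typical {Q n : ℕ} (α : Mix Q) (π : Conn Q) (η θ δ c a : ℝ) (z : Fin n → Fin Q)
    (x : Graph n) : Prop where
  abs_classDev_le : ∀ q, |classDev α q z| ≤ η * n
  abs_blockDev_le : ∀ q l, |blockDev π q l z x| ≤ θ * (n : ℝ) ^ 2
  farLik_le : farLik c a π z x ≤ Real.exp (δ * n) * edgeLik π x z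
  edgeLik_pos : 0 < edgeLik π x z

lemma IsSBM.measure_edgeLik_eq_zero {Q : ℕ} {Ω : Type*} [MeasurableSpace Ω] {P : Measure Ω}
    {α : Mix Q} {π : Conn Q} {Z : ℕ → Ω → Fin Q} {X : ℕ → ℕ → Ω → Bool}
    (h : IsSBM P α π Z X) (hα : ∀ q, 0 ≤ α q) (hπ : ∀ q l, π q l ∈ Set.Icc (0 : ℝ) 1) (n : ℕ) :
    P {ω | edgeLik π (adj X n ω) (fun i : Fin n => Z i ω) = 0} = 0 := by
  -- `F = 0` is admissible, since the event excludes graphs of positive probability.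
  have h1 := h.measure_le_of_one_le hα hπ (n := n) (fun z x => graphProb π z x = 0)
    (fun _ _ => 0) (fun _ _ => le_rfl) (fun z x h2 h3 => absurd h2 h3.ne')
  have h2 : {ω | edgeLik π (adj X n ω) (fun i : Fin n => Z i ω) = 0} =
      {ω | graphProb π (fun i : Fin n => Z i ω) (adj X n ω) = 0} := by
    ext ω
    rw [Set.mem_ofPred_eq, Set.mem_ofPred_eq, graphProb_eq_edgeLik]
    exact fun i => h.no_loop i ω
  rw [h2]
  simpa using h1

lemma IsSBM.tendsto_not_typical {Q : ℕ} {Ω : Type*} [MeasurableSpace Ω] {P : Measure Ω}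
    {α : Mix Q} {π : Conn Q} {Z : ℕ → Ω → Fin Q} {X : ℕ → ℕ → Ω → Bool}
    (h : IsSBM P α π Z X) (hα : ∀ q, 0 ≤ α q) (hα1 : ∑ q, α q = 1)
    (hπ : ∀ q l, π q l ∈ Set.Icc (0 : ℝ) 1) {η θ δ c a : ℝ} (hη : 0 < η) (hη1 : η ≤ 1)
    (hθ : 0 < θ) (hθ1 : θ ≤ 1) (hδ : 0 < δ) (hc : 0 < c) (ha : 0 ≤ a) :
    Tendsto (fun n : ℕ => P {ω | ¬ Typical α π η θ δ c a (fun i : Fin n => Z i ω)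
      (adj X n ω)}) atTop (𝓝 0) := by
  have h1 := tendsto_finsetSum (Finset.univ : Finset (Fin Q))
    fun q _ => h.tendsto_classDev hα hα1 hπ hη hη1 q
  have h2 := tendsto_finsetSum (Finset.univ : Finset (Fin Q)) fun q _ =>
    tendsto_finsetSum (Finset.univ : Finset (Fin Q))
      fun l _ => h.tendsto_blockDev hα hα1 hπ hθ hθ1 q l
  have h3 := h.tendsto_farLik hα hα1 hπ hc ha hδ
  have h4 := (h1.add h2).add h3
  simp only [Finset.sum_const_zero, add_zero] at h4
  refine tendsto_of_tendsto_of_tendsto_of_le_of_le tendsto_const_nhds h4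
    (fun _ => zero_le) fun n => ?_
  have hsub : {ω | ¬ Typical α π η θ δ c a (fun i : Fin n => Z i ω) (adj X n ω)} ⊆
      (((⋃ q, {ω | η * n < |classDev α q (fun i : Fin n => Z i ω)|}) ∪
        ⋃ q, ⋃ l, {ω | θ * (n : ℝ) ^ 2 <
          |blockDev π q l (fun i : Fin n => Z i ω) (adj X n ω)|}) ∪
        {ω | Real.exp (δ * n) * edgeLik π (adj X n ω) (fun i : Fin n => Z i ω) <
          farLik c a π (fun i : Fin n => Z i ω) (adj X n ω)}) ∪
        {ω | edgeLik π (adj X n ω) (fun i : Fin n => Z i ω) = 0} := by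
    intro ω hω
    by_contra hcon
    simp only [Set.mem_union, Set.mem_iUnion, Set.mem_ofPred_eq, not_or, not_exists,
      not_lt] at hcon
    obtain ⟨⟨⟨c1, c2⟩, c3⟩, c4⟩ := hcon
    exact hω ⟨c1, c2, c3, lt_of_le_of_ne (edgeLik_nonneg hπ _ _) (Ne.symm c4)⟩
  refine (measure_mono hsub).trans ((measure_union_le _ _).trans ?_)
  rw [h.measure_edgeLik_eq_zero hα hπ n, add_zero]
  refine (measure_union_le _ _).trans (add_le_add_left ((measure_union_le _ _).trans ?_) _)
  refine add_le_add (measure_iUnion_fintype_le _ _) ((measure_iUnion_fintype_le _ _).trans ?_)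
  exact Finset.sum_le_sum fun q _ => measure_iUnion_fintype_le _ _

lemma card_class_ge_of_abs_classDev_le {Q n : ℕ} {γ η : ℝ} {α : Mix Q} {q : Fin Q}
    {z : Fin n → Fin Q} (hα : γ ≤ α q) (hη : η ≤ γ / 2) (h : |classDev α q z| ≤ η * n) :
    γ / 2 * n ≤ (Finset.univ.filter fun i => z i = q).card := by
  have h1 : classDev α q z = (Finset.univ.filter fun i => z i = q).card - n * α q := by
    simp [classDev, Finset.sum_sub_distrib]
  have h2 := (abs_le.1 h).1
  have hn : (0 : ℝ) ≤ n := Nat.cast_nonneg n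
  rw [h1] at h2
  nlinarith [mul_le_mul_of_nonneg_left hα hn, mul_le_mul_of_nonneg_right hη hn]

/-- On typical graphs, variational estimates with `π̃` within `M / n` of the truth have group
proportions close to the truth, up to a permutation that leaves `π` invariant. -/
lemma exists_invPerm_sq_sub_le {Q : ℕ} {ζ γ η θ δ c a M : ℝ} {α : Mix Q} {π : Conn Q}
    (hζ : 0 < ζ) (hγ : 0 < γ) (hα : TruncMix γ α) (hπ : TruncConn ζ π) (hM : 0 ≤ M)
    (hη : η ≤ γ / 2)
    (hθ : Q ^ 2 * (2 * M / ζ ^ 2 * θ) ≤ δ / 2) (hδ : 0 < δ)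
    (ha : Real.exp (4 * (M / ζ)) * γ⁻¹ ≤ a ^ 2)
    (hident : ∀ᶠ n : ℕ in atTop, ∀ zs : Fin n → Fin Q,
      (∀ q, γ / 2 * n ≤ (Finset.univ.filter fun i => zs i = q).card) → ∀ z : Fin n → Fin Q,
        ∃ σ ∈ invPerms π, c * n * hammingDist z (fun i => σ (zs i)) ≤ (mismatch π z zs).card) :
    ∀ᶠ n : ℕ in atTop, ∀ (zs : Fin n → Fin Q) (x : Graph n) (α' : Mix Q) (π' : Conn Q),
      Typical α π η θ δ c a zs x → IsVE ζ γ x α' π' → n * ‖π' - π‖ ≤ M →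
        ∃ σ ∈ invPerms π, ∀ q, (α q - α' (σ q)) ^ 2 ≤ 4 * (2 * δ + Q * (η * -Real.log γ)) := by
  have hlim : Tendsto (fun n : ℕ => M / n) atTop (𝓝 0) :=
    tendsto_const_nhds.div_atTop tendsto_natCast_atTop_atTop
  have hlin : ∀ᶠ n : ℕ in atTop, 2 * M ^ 2 / ζ ^ 2 ≤ δ / 2 * n :=
    (tendsto_natCast_atTop_atTop.const_mul_atTop (half_pos hδ)).eventually_ge_atTop _
  filter_upwards [hident, hlim.eventually_lt_const hζ, hlim.eventually_lt_const zero_lt_one,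
    hlin, eventually_gt_atTop 0] with n hid heζ he1 hn2 hn zs x α' π' hT hVE hrate
  have hn' : (0 : ℝ) < n := by exact_mod_cast hn
  have h' : ∀ q l, |π' q l - π q l| ≤ M / n := fun q l => by
    rw [le_div_iff₀ hn', mul_comm]
    refine le_trans (mul_le_mul_of_nonneg_left ?_ hn'.le) hrate
    exact (norm_le_pi_norm ((π' - π) q) l).trans (norm_le_pi_norm (π' - π) q)
  obtain ⟨σ, hσ, hle⟩ := exists_invPerm_prod_le (e := M / n) (c := c) (a := a)
    (E := Real.exp (δ * n)) hζ hγ hα hπ (by positivity) heζ he1 h' hVE hT.edgeLik_pos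
    (hid zs fun q => card_class_ge_of_abs_classDev_le (hα.2 q).1 hη (hT.abs_classDev_le q))
    hT.abs_blockDev_le
    (by
      -- The rate `1 / n` is what makes the cost per misclassified vertex independent of `n`.
      have : 4 * (M / n / ζ) * n = 4 * (M / ζ) := by field_simp
      rwa [this]) hT.farLik_le
  refine ⟨σ, hσ, sq_sub_le_of_prod_le (β := fun q => α' (σ q)) hγ hn hα
    ⟨by rw [← hVE.1.1]; exact Equiv.sum_comp σ α', fun q => hVE.1.2 (σ q)⟩
    hT.abs_classDev_le (hle.trans ?_)⟩
  refine mul_le_mul_of_nonneg_right ?_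
    (Finset.prod_nonneg fun i _ => hγ.le.trans (hVE.1.2 _).1)
  rw [← Real.exp_add]
  refine Real.exp_le_exp.2 ?_
  -- The first-order term is at most `δ n / 2` by the choice of `θ`; the second-order one is
  -- constant, hence eventually below `δ n / 2`. With the factor `exp (δ n)` from `farLik` the total
  -- is `2 δ n`.
  have h1 : Q ^ 2 * (2 * (M / n) / ζ ^ 2 * (θ * (n : ℝ) ^ 2)) =
      Q ^ 2 * (2 * M / ζ ^ 2 * θ) * n := by field_simp
  have h2 : (n : ℝ) ^ 2 * (2 * (M / n) ^ 2 / ζ ^ 2) = 2 * M ^ 2 / ζ ^ 2 := by field_simp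
  rw [h1, h2]
  nlinarith [mul_le_mul_of_nonneg_right hθ hn'.le]

lemma TruncMix.pos_of_sum {Q : ℕ} {γ : ℝ} {α : Mix Q} (h : TruncMix γ α) : 0 < Q := by
  rcases Nat.eq_zero_or_pos Q with rfl | h1
  · simpa using h.1
  · exact h1

end SBM

end

/-! ### Consistency of the estimated proportions -/

theorem theorem4p2 {Q : ℕ} {ζ γ : ℝ} (hζ : 0 < ζ) (hγ : 0 < γ) (hγQ : γ < 1 / (Q : ℝ))
    {Ω : Type*} [MeasurableSpace Ω] (P : Measure Ω) [IsProbabilityMeasure P]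
    (αs : SBM.Mix Q) (πs : SBM.Conn Q)
    (hA1 : SBM.DistinctClasses πs) (hA2 : SBM.TruncConn ζ πs) (hA3 : SBM.TruncMix γ αs)
    (Z : ℕ → Ω → Fin Q) (X : ℕ → ℕ → Ω → Bool) (hSBM : SBM.IsSBM P αs πs Z X)
    (αt : (n : ℕ) → SBM.Graph n → SBM.Mix Q) (πt : (n : ℕ) → SBM.Graph n → SBM.Conn Q)
    (hVE : ∀ (n : ℕ) (x : SBM.Graph n), SBM.IsVE ζ γ x (αt n x) (πt n x))
    (hrate : SBM.ConvAtRateInv P (fun n ω => πt n (SBM.adj X n ω)) πs)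
    (d : SBM.Mix Q → SBM.Mix Q → ℝ) (hd : SBM.IsUsualDist d) :
    ∀ ε : ℝ, 0 < ε →
      Tendsto
        (fun n : ℕ =>
          P {ω | ∀ σ ∈ SBM.invPerms πs, ε < d (fun q => αt n (SBM.adj X n ω) (σ q)) αs})
        atTop (𝓝 0) := by
  intro ε hε
  have hQ : 0 < Q := hA3.pos_of_sum
  have hQ' : (0 : ℝ) < Q := by exact_mod_cast hQ
  have hα0 : ∀ q, 0 ≤ αs q := fun q => hγ.le.trans (hA3.2 q).1
  have hπ : ∀ q l, πs q l ∈ Set.Icc (0 : ℝ) 1 := fun q l => (hA2 q l).1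
  have hγ1 : γ ≤ 1 := by linarith [(hA3.2 ⟨0, hQ⟩).1, (hA3.2 ⟨0, hQ⟩).2]
  set L : ℝ := -Real.log γ with hL
  have hL0 : 0 ≤ L := neg_nonneg.2 (Real.log_nonpos hγ.le hγ1)
  obtain ⟨s, hs, hds⟩ := hd.exists_forall_abs_sub_lt αs hε
  -- The final bound is `4 (2 δ + δ) = 3 s ^ 2 / 8`, below `s ^ 2`.
  set δ : ℝ := s ^ 2 / 32 with hδ
  have hδ0 : 0 < δ := by positivity
  set η : ℝ := min (γ / 2) (δ / (Q * (L + 1))) with hη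
  have hη0 : 0 < η := by positivity
  have hηγ : η ≤ γ / 2 := min_le_left _ _
  have hηL : Q * (η * L) ≤ δ := by
    have h1 : η ≤ δ / (Q * (L + 1)) := min_le_right _ _
    rw [le_div_iff₀ (by positivity)] at h1
    nlinarith [mul_pos hη0 hQ']
  obtain ⟨c, hc, hident⟩ := SBM.exists_invPerm_card_mismatch_ge hA1 hQ (half_pos hγ)
  rw [ENNReal.tendsto_nhds_zero]
  intro ρ hρ
  -- The tolerance is shared between the failure of the rate and the atypical graphs. The constants
  -- `M`, `θ` and `a` depend on it, so they are chosen afterwards.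
  obtain ⟨r, hr0, hrρ⟩ : ∃ r : ℝ, 0 < r ∧ ENNReal.ofReal r + ENNReal.ofReal r ≤ ρ := by
    have h1 : Tendsto (fun r : ℝ => ENNReal.ofReal r + ENNReal.ofReal r) (𝓝[>] 0) (𝓝 0) := by
      have : Continuous fun r : ℝ => ENNReal.ofReal r + ENNReal.ofReal r :=
        ENNReal.continuous_ofReal.add ENNReal.continuous_ofReal
      simpa using (this.tendsto 0).mono_left nhdsWithin_le_nhds
    obtain ⟨r, hr, hr0⟩ := ((h1.eventually_le_const hρ).and self_mem_nhdsWithin).exists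
    exact ⟨r, hr0, hr⟩
  obtain ⟨M₀, hM₀⟩ := hrate r hr0
  set M : ℝ := max M₀ 1 with hM
  have hM1 : 1 ≤ M := le_max_right _ _
  set θ : ℝ := min 1 (δ / 2 / (Q ^ 2 * (2 * M / ζ ^ 2))) with hθ
  have hθ0 : 0 < θ := by positivity
  have hθδ : Q ^ 2 * (2 * M / ζ ^ 2 * θ) ≤ δ / 2 := by
    have h1 : θ ≤ δ / 2 / (Q ^ 2 * (2 * M / ζ ^ 2)) := min_le_right _ _
    rw [le_div_iff₀ (by positivity)] at h1
    linarith
  set a : ℝ := √(Real.exp (4 * (M / ζ)) * γ⁻¹) with ha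
  have ha2 : Real.exp (4 * (M / ζ)) * γ⁻¹ ≤ a ^ 2 :=
    (Real.sq_sqrt (by positivity)).ge
  have htyp := hSBM.tendsto_not_typical hα0 hA3.1 hπ hη0 (by linarith) hθ0 (min_le_left _ _)
    hδ0 hc (Real.sqrt_nonneg (Real.exp (4 * (M / ζ)) * γ⁻¹))
  have hdet := SBM.exists_invPerm_sq_sub_le (η := η) (θ := θ) (δ := δ) (c := c) (a := a) (M := M)
    hζ hγ hA3 hA2 (by linarith) hηγ hθδ hδ0 ha2 hident
  filter_upwards [hM₀, hdet, htyp.eventually_le_const (ENNReal.ofReal_pos.2 hr0)]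
    with n hn1 hn2 hn3
  refine le_trans (le_trans (measure_mono ?_) ((measure_union_le _ _).trans
    (add_le_add hn1 hn3))) hrρ
  intro ω hω
  by_contra hcon
  simp only [Set.mem_union, Set.mem_ofPred_eq, not_or, not_lt, not_not] at hcon
  obtain ⟨σ, hσ, hle⟩ := hn2 _ _ _ _ hcon.2 (hVE n _) (hcon.1.trans (le_max_left _ _))
  refine absurd (hω σ hσ) (not_lt.2 (hds _ fun q => ?_))
  rw [abs_sub_comm]
  refine abs_lt_of_sq_lt_sq ((hle q).trans_lt ?_) hs.le
  nlinarith [sq_pos_of_pos hs]
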